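/- For $n=0,1,2,\dots$ and real $z>1$ let $$P_n(z)=\frac{1}{2^n n!}\frac{d^n}{dz^n}(z^2-1)^n,\qquad Q_n(z)=\frac12 P_n(z)\log\frac{z+1}{z-1}-\sum_{k=1}^n\frac1k P_{k-1}(z)P_{n-k}(z)$$ be the Legendre functions of the first and second kind, and let $$P_n^m=(z^2-1)^{m/2}\frac{d^m P_n}{dz^m},\quad Q_n^m=(z^2-1)^{m/2}\frac{d^m Q_n}{dz^m}\quad(0\le m\le n),\qquad P_n^{-m}=\frac{(n-m)!}{(n+m)!}P_n^m,\quad Q_n^{-m}=\frac{(n-m)!}{(n+m)!}Q_n^m\quad(1\le m\le n)$$ be the associated Legendre functions on $(1,\infty)$. For $n\ge 1$ and $-n\le m\le n$, the Neumann–Poincaré eigenvalues of the prolate spheroid with $\xi=L$ in prolate spheroidal coordinates (equivalently, up to dilation, $x_1^2+x_2^2+x_3^2/R^2<1$ with $R=L/\sqrt{L^2-1}$) are given by $$\lambda_{m,n}(L)=-\frac12(-1)^m\frac{(n-m)!}{(n+m)!}(L^2-1)\,(P_n^mQ_n^m)'(L)\quad(1<L<\infty),\qquad \lambda_{m,n}(\infty)=\frac{1}{2(2n+1)},$$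 where $L=\infty$ is the sphere. Then: (i) For each $n\ge1$, $$\bigcup_{1<L\le\infty}\{\lambda_{m,n}(L): -n\le m\le n\}=(0,1/2),$$ and for each $n\ge 2$ the sphere is not needed: $$\bigcup_{1<L<\infty}\{\lambda_{m,n}(L): -n\le m\le n\}=(0,1/2).$$ (ii) For every $L_0\in(1,\infty]$, $$\bigcup_{1<L\le L_0}\{\lambda_{0,n}(L): n=1,2,\dots\}=(0,1/2).$$ -/

import Mathlib

noncomputable section

namespace ProlateNP

/-- The Legendre polynomial `P_n`, by Rodrigues' formula `(1 / (2^n n!)) (d/dz)^n (z^2 - 1)^n`. -/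
def legendreP (n : ℕ) : Polynomial ℝ :=
  Polynomial.C (1 / (2 ^ n * (n.factorial : ℝ))) *
    Polynomial.derivative^[n] ((Polynomial.X ^ 2 - 1) ^ n)

/-- The Legendre function of the second kind `Q_n` on the half-line `z > 1`:
`Q_n(z) = (1/2) P_n(z) log ((z+1)/(z-1)) - ∑_{k=1}^n (1/k) P_{k-1}(z) P_{n-k}(z)`. -/
def legendreQ (n : ℕ) (z : ℝ) : ℝ :=
  1 / 2 * (legendreP n).eval z * Real.log ((z + 1) / (z - 1)) -
    ∑ k ∈ Finset.Icc 1 n, 1 / (k : ℝ) * (legendreP (k - 1)).eval z * (legendreP (n - k)).eval z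

/-- The constant relating orders `-k` and `k` (for `1 ≤ k ≤ n`): on `z > 1` both kinds of associated
Legendre functions of degree `n` satisfy `F_n^{-k} = ((n-k)! / (n+k)!) F_n^k`.
For `m ≥ 0` the constant is `1`. -/
def orderFactor (m : ℤ) (n : ℕ) : ℝ :=
  if 0 ≤ m then 1
  else ((n - m.natAbs).factorial : ℝ) / ((n + m.natAbs).factorial : ℝ)

/-- The associated Legendre function of the first kind `P_n^m` on `z > 1` (`-n ≤ m ≤ n`):
`P_n^m(z) = (z^2-1)^{m/2} (d/dz)^m P_n(z)` for `m ≥ 0`, and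
`P_n^{-m} = ((n-m)!/(n+m)!) P_n^m`. -/
def assocLegendreP (m : ℤ) (n : ℕ) (z : ℝ) : ℝ :=
  orderFactor m n * (Real.sqrt (z ^ 2 - 1) ^ m.natAbs *
    iteratedDeriv m.natAbs (fun x => (legendreP n).eval x) z)

/-- The associated Legendre function of the second kind `Q_n^m` on `z > 1` (`-n ≤ m ≤ n`):
`Q_n^m(z) = (z^2-1)^{m/2} (d/dz)^m Q_n(z)` for `m ≥ 0`, and
`Q_n^{-m} = ((n-m)!/(n+m)!) Q_n^m`. -/
def assocLegendreQ (m : ℤ) (n : ℕ) (z : ℝ) : ℝ :=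
  orderFactor m n * (Real.sqrt (z ^ 2 - 1) ^ m.natAbs *
    iteratedDeriv m.natAbs (legendreQ n) z)

/-- The Neumann–Poincaré eigenvalue `λ_{m,n}(L)` of the prolate spheroid `ξ = L`, `1 < L < ∞`:
`λ_{m,n}(L) = (-1/2) (-1)^m ((n-m)!/(n+m)!) (L^2 - 1) (P_n^m Q_n^m)'(L)`, for `-n ≤ m ≤ n`. -/
def eigenvalue (m : ℤ) (n : ℕ) (L : ℝ) : ℝ :=
  (-1 / 2) * (-1) ^ m *
    ((((n : ℤ) - m).toNat.factorial : ℝ) / (((n : ℤ) + m).toNat.factorial : ℝ)) *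
    (L ^ 2 - 1) * deriv (fun z => assocLegendreP m n z * assocLegendreQ m n z) L

/-- The eigenvalues for `1 < L ≤ ∞`; `L = ∞` is the sphere, where `λ_{m,n}(∞) = 1/(2(2n+1))`. -/
def eigenvalueExt (m : ℤ) (n : ℕ) (L : EReal) : ℝ :=
  if L = ⊤ then 1 / (2 * (2 * (n : ℝ) + 1)) else eigenvalue m n L.toReal

end ProlateNP

end

namespace ProlateNP

open Polynomial Filter Topology

/-! ### Legendre polynomials -/

/-! Put k = |m|, u = P_n^k, v = (-1)^k ((n-k)!/(n+k)!) Q_n^k, A = (z² - 1) u' and B = (z² - 1) v'.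
With this normalization the Wronskian identity is A v - u B = 1, so the eigenvalue is 1/2 - A v
(`eigenvalue_eq`) and only the product A v has to be understood.

Bounds. A v > 0 because u increases and v is positive. Let q = `charRoot`, that is q² = n(n+1)(z² -
1) + k². The associated Legendre equation reads (z² - 1) A' = q² u, and likewise for B and v. Since
q increases, comparison from the end point 1 gives A < q u, and comparison from infinity gives B <
-q v (`A_lt`, `B_lt`). Hence A v < q u v < -u B = 1 - A v, so A v < 1/2.

Covering for fixed n. At infinity the Wronskian and l'Hôpital's rule give A v → n/(2n+1), so every
order tends to the value of the sphere. At 1 the eigenvalue tends to 1/2 for m = 0 and to 0 for m =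
1. By the intermediate value theorem these two orders cover (0, 1/2) except possibly the value of
the sphere. For n ≥ 2 a second-order expansion at infinity shows that the eigenvalue with m = 1
somewhere exceeds its limit, so it also attains it (`exists_lt_eigenvalue_one`).

Covering for m = 0 near 1. The eigenvalue is -(1/2)(z² - 1)(u v)', and q u v < 1 forces u v = O(1/n)
at a fixed point. By the mean value theorem it is small somewhere in any given interval once n is
large (`exists_eigenvalue_zero_lt`), while near 1 it is close to 1/2.

The facts about Q_n come from its three-term recurrence, which a generating function extracts from
the explicit formula. -/

theorem iterate_derivative_X_mul_succ (f : ℝ[X]) (k : ℕ) :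
    derivative^[k + 1] (X * f) = X * derivative^[k + 1] f + (k + 1 : ℝ[X]) * derivative^[k] f := by
  induction k with
  | zero => simp; ring
  | succ k ih =>
    rw [Function.iterate_succ_apply', ih, Function.iterate_succ_apply' _ (k + 1) f]
    have h : derivative (derivative^[k] f) = derivative^[k + 1] f :=
      (Function.iterate_succ_apply' _ _ _).symm
    have h' : derivative ((k : ℝ[X]) + 1) = 0 := by simp
    rw [derivative_add, derivative_mul, derivative_mul, h, h', derivative_X]
    push_cast
    ring

theorem legendreP_succ_eq (n : ℕ) :
    legendreP (n + 1) = C (1 / (2 ^ n * (n.factorial : ℝ))) *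
      derivative^[n] (X * (X ^ 2 - 1) ^ n) := by
  have h : derivative ((X ^ 2 - 1 : ℝ[X]) ^ (n + 1))
      = C (2 * (n + 1) : ℝ) * (X * (X ^ 2 - 1) ^ n) := by
    rw [derivative_pow_succ]
    simp only [derivative_sub, derivative_X_pow, derivative_one, map_mul, map_add, map_natCast,
      map_one, Nat.cast_ofNat, map_ofNat]
    ring
  rw [legendreP, Function.iterate_succ_apply, h, iterate_derivative_C_mul, ← mul_assoc, ← C_mul]
  congr 2
  rw [Nat.factorial_succ]
  push_cast
  field_simp
  ring

theorem derivative_legendreP_succ (n : ℕ) :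
    derivative (legendreP (n + 1)) =
      X * derivative (legendreP n) + (n + 1 : ℝ[X]) * legendreP n := by
  rw [legendreP_succ_eq, derivative_C_mul, ← Function.iterate_succ_apply' derivative,
    iterate_derivative_X_mul_succ, legendreP, derivative_C_mul,
    ← Function.iterate_succ_apply' derivative]
  ring

/-- Differentiate (X² - 1) w' = 2(k+1) X w, where w = (X² - 1)^(k+1), k+1 times. Writing X² as two
nested factors X leaves only the Leibniz rule for multiplication by X. -/
theorem sq_sub_one_mul_iterate_derivative (k : ℕ) :
    (X ^ 2 - 1) * derivative^[k + 2] ((X ^ 2 - 1 : ℝ[X]) ^ (k + 1)) =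
      ((k + 2) * (k + 1) : ℝ[X]) * derivative^[k] ((X ^ 2 - 1) ^ (k + 1)) := by
  set w : ℝ[X] := (X ^ 2 - 1) ^ (k + 1) with hw
  have hw' : X * (X * derivative w) = derivative w + (2 * (k + 1) : ℝ[X]) * (X * w) := by
    rw [hw, derivative_pow_succ]
    simp only [derivative_sub, derivative_X_pow, derivative_one, map_add, map_natCast,
      map_one, Nat.cast_ofNat, map_ofNat]
    ring
  have e1 : derivative^[k + 1] (derivative w) = derivative^[k + 2] w := rfl
  have e2 : derivative^[k] (derivative w) = derivative^[k + 1] w := rfl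
  have h1 := congrArg (derivative^[k + 1]) hw'
  have h2 : X * derivative w = derivative (X * w) - w := by
    rw [derivative_mul, derivative_X]; ring
  have h3 : derivative^[k] (X * derivative w)
      = X * derivative^[k + 1] w + (k : ℝ[X]) * derivative^[k] w := by
    rw [h2, iterate_derivative_sub, ← Function.iterate_succ_apply derivative,
      iterate_derivative_X_mul_succ]
    ring
  have h4 : derivative^[k + 1] ((2 * (k + 1) : ℝ[X]) * (X * w))
      = (2 * (k + 1) : ℝ[X]) * derivative^[k + 1] (X * w) := by
    have : (2 * (k + 1) : ℝ[X]) = C (2 * (k + 1) : ℝ) := by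
      simp only [map_mul, map_add, map_natCast, map_one, map_ofNat]
    rw [this, iterate_derivative_C_mul]
  rw [iterate_derivative_X_mul_succ, h3, iterate_derivative_X_mul_succ, iterate_map_add, h4,
    iterate_derivative_X_mul_succ, e1, e2] at h1
  linear_combination h1

theorem legendreP_zero : legendreP 0 = 1 := by simp [legendreP]

theorem legendreP_one : legendreP 1 = X := by simp [legendreP_succ_eq]

theorem sq_sub_one_mul_derivative_legendreP (n : ℕ) :
    (X ^ 2 - 1) * derivative (legendreP n) =
      (n + 1 : ℝ[X]) * (legendreP (n + 1) - X * legendreP n) := by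
  cases n with
  | zero => simp [legendreP_zero, legendreP_one]
  | succ k =>
    rw [legendreP_succ_eq (k + 1), iterate_derivative_X_mul_succ, legendreP, derivative_C_mul,
      ← Function.iterate_succ_apply' derivative]
    have := sq_sub_one_mul_iterate_derivative k
    push_cast
    linear_combination (C (1 / (2 ^ (k + 1) * ((k + 1).factorial : ℝ)))) * this

theorem sq_sub_one_mul_derivative_legendreP_succ (n : ℕ) :
    (X ^ 2 - 1) * derivative (legendreP (n + 1)) =
      (n + 1 : ℝ[X]) * (X * legendreP (n + 1) - legendreP n) := by
  rw [derivative_legendreP_succ]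
  linear_combination X * sq_sub_one_mul_derivative_legendreP n

theorem legendreP_three_term (n : ℕ) :
    (n + 2 : ℝ[X]) * legendreP (n + 2) =
      (2 * n + 3 : ℝ[X]) * X * legendreP (n + 1) - (n + 1 : ℝ[X]) * legendreP n := by
  have h1 := sq_sub_one_mul_derivative_legendreP (n + 1)
  have h2 := sq_sub_one_mul_derivative_legendreP_succ n
  push_cast at h1
  linear_combination h2 - h1

/-! ### Degree and leading coefficient. -/

theorem natDegree_legendreP_le (n : ℕ) : (legendreP n).natDegree ≤ n := by
  refine (natDegree_C_mul_le _ _).trans ((natDegree_iterate_derivative _ _).trans ?_)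
  have : ((X ^ 2 - 1 : ℝ[X]) ^ n).natDegree ≤ n * 2 := by
    refine natDegree_pow_le_of_le n ?_
    compute_degree
  omega

theorem coeff_legendreP_pos (n : ℕ) : 0 < (legendreP n).coeff n := by
  have h2 : (X ^ 2 - 1 : ℝ[X]).natDegree ≤ 2 := by compute_degree
  have h3 : (X ^ 2 - 1 : ℝ[X]).coeff 2 = 1 := by simp [coeff_one]
  have h : ((X ^ 2 - 1 : ℝ[X]) ^ n).coeff (n + n) = 1 := by
    have := coeff_pow_of_natDegree_le h2 (m := n)
    rw [← two_mul, mul_comm, this, h3, one_pow]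
  rw [legendreP, coeff_C_mul, coeff_iterate_derivative, h]
  have : 0 < (n + n).descFactorial n := Nat.descFactorial_pos.2 (by omega)
  simp only [nsmul_eq_mul, mul_one]
  positivity

/-- The `m`-th derivative of the Legendre polynomial, as a function. -/
noncomputable def legendreD (n m : ℕ) (z : ℝ) : ℝ := (derivative^[m] (legendreP n)).eval z

theorem hasDerivAt_legendreD (n m : ℕ) (z : ℝ) :
    HasDerivAt (legendreD n m) (legendreD n (m + 1) z) z := by
  unfold legendreD
  rw [Function.iterate_succ_apply']
  exact Polynomial.hasDerivAt _ _

theorem continuous_legendreD (n m : ℕ) : Continuous (legendreD n m) :=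
  Polynomial.continuous _

theorem iteratedDeriv_legendreP (n m : ℕ) :
    iteratedDeriv m (fun x => (legendreP n).eval x) = legendreD n m := by
  induction m with
  | zero => rfl
  | succ m ih =>
    rw [iteratedDeriv_succ, ih]
    exact funext fun z => (hasDerivAt_legendreD n m z).deriv

theorem legendreD_zero_left_zero (z : ℝ) : legendreD 0 0 z = 1 := by
  simp [legendreD, legendreP_zero]

theorem legendreD_one_left_zero (z : ℝ) : legendreD 1 0 z = z := by
  simp [legendreD, legendreP_one]

theorem sq_sub_one_mul_legendreD_one (n : ℕ) (z : ℝ) :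
    (z ^ 2 - 1) * legendreD n 1 z = (n + 1) * (legendreD (n + 1) 0 z - z * legendreD n 0 z) := by
  have := congrArg (eval z) (sq_sub_one_mul_derivative_legendreP n)
  simpa [legendreD] using this

theorem sq_sub_one_mul_legendreD_succ_one (n : ℕ) (z : ℝ) :
    (z ^ 2 - 1) * legendreD (n + 1) 1 z =
      (n + 1) * (z * legendreD (n + 1) 0 z - legendreD n 0 z) := by
  have := congrArg (eval z) (sq_sub_one_mul_derivative_legendreP_succ n)
  simpa [legendreD] using this

theorem legendreD_three_term (n : ℕ) (z : ℝ) :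
    (n + 2) * legendreD (n + 2) 0 z =
      (2 * n + 3) * z * legendreD (n + 1) 0 z - (n + 1) * legendreD n 0 z := by
  have := congrArg (eval z) (legendreP_three_term n)
  simpa [legendreD] using this

theorem legendreD_succ_succ (n m : ℕ) (z : ℝ) :
    legendreD (n + 1) (m + 1) z =
      z * legendreD n (m + 1) z + (n + m + 1) * legendreD n m z := by
  induction m generalizing z with
  | zero =>
    have := congrArg (eval z) (derivative_legendreP_succ n)
    simpa [legendreD] using this
  | succ m ih =>
    have h1 := hasDerivAt_legendreD (n + 1) (m + 1) z
    rw [funext ih] at h1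
    have h2 := ((hasDerivAt_id z).mul (hasDerivAt_legendreD n (m + 1) z)).add
      ((hasDerivAt_legendreD n m z).const_mul (n + m + 1 : ℝ))
    have h3 := h1.unique h2
    simp only [id] at h3
    rw [h3]
    push_cast
    ring

theorem legendreD_nonneg (n m : ℕ) {z : ℝ} (hz : 1 ≤ z) : 0 ≤ legendreD n m z := by
  induction n generalizing m with
  | zero =>
    cases m with
    | zero => simp [legendreD_zero_left_zero]
    | succ m => simp [legendreD, legendreP_zero]
  | succ n ih =>
    cases m with
    | zero =>
      have h := sq_sub_one_mul_legendreD_one n z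
      have h0 := ih 0
      have h1 := ih 1
      have hp : 0 ≤ z ^ 2 - 1 := by nlinarith
      have : 0 ≤ (n + 1) * legendreD (n + 1) 0 z := by
        have : (n + 1) * legendreD (n + 1) 0 z
          = (z ^ 2 - 1) * legendreD n 1 z + (n + 1) * (z * legendreD n 0 z) := by linarith
        rw [this]; positivity
      exact nonneg_of_mul_nonneg_right this (by positivity)
    | succ m =>
      rw [legendreD_succ_succ]
      have h0 := ih m
      have h1 := ih (m + 1)
      positivity

/-- Both recursions, P_{n+1} = z P_n + (z² - 1) P_n'/(n+1) and `legendreD_succ_succ`, have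
nonnegative terms on z ≥ 1, one of which is already at least 1. This bound supplies the nonvanishing
of the denominators below. -/
theorem one_le_legendreD {n m : ℕ} (hm : m ≤ n) {z : ℝ} (hz : 1 ≤ z) : 1 ≤ legendreD n m z := by
  induction n generalizing m with
  | zero =>
    obtain rfl : m = 0 := by omega
    simp [legendreD_zero_left_zero]
  | succ n ih =>
    cases m with
    | zero =>
      have h := sq_sub_one_mul_legendreD_one n z
      have h0 := ih (Nat.zero_le n)
      have h1 := legendreD_nonneg n 1 hz
      have hp : 0 ≤ z ^ 2 - 1 := by nlinarith
      have h2 : 0 ≤ (z ^ 2 - 1) * legendreD n 1 z := mul_nonneg hp h1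
      rw [h] at h2
      have := nonneg_of_mul_nonneg_right h2 (by positivity)
      nlinarith
    | succ m =>
      rw [legendreD_succ_succ]
      have h0 := ih (m := m) (by omega)
      have h1 := mul_nonneg (zero_le_one.trans hz) (legendreD_nonneg n (m + 1) hz)
      have h2 : (0 : ℝ) ≤ n + m := by positivity
      nlinarith

theorem legendreD_zero_apply_one (n : ℕ) : legendreD n 0 1 = 1 := by
  induction n with
  | zero => exact legendreD_zero_left_zero 1
  | succ n ih =>
    have h := sq_sub_one_mul_legendreD_one n 1
    have hn : (n + 1 : ℝ) ≠ 0 := by positivity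
    have : legendreD (n + 1) 0 1 - 1 * legendreD n 0 1 = 0 := by
      simpa [hn] using h.symm
    linarith

/-- If `F` lists the successive derivatives of a solution of Legendre's equation, then each of them
satisfies the correspondingly differentiated equation. -/
theorem differentiated_legendre_equation {F : ℕ → ℝ → ℝ} {N : ℝ}
    (hF : ∀ m, ∀ z > 1, HasDerivAt (F m) (F (m + 1) z) z)
    (h0 : ∀ z > 1, (z ^ 2 - 1) * F 2 z + 2 * z * F 1 z = N * F 0 z) (m : ℕ) :
    ∀ z > 1, (z ^ 2 - 1) * F (m + 2) z + 2 * (m + 1) * z * F (m + 1) z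
      = (N - m * (m + 1)) * F m z := by
  induction m with
  | zero => intro z hz; simpa using h0 z hz
  | succ m ih =>
    intro z hz
    have hp : HasDerivAt (fun x : ℝ => x ^ 2 - 1) (2 * z) z := by
      simpa using (hasDerivAt_pow 2 z).sub_const 1
    have hl := (hp.mul (hF (m + 2) z hz)).add
      (((hasDerivAt_id z).const_mul (2 * (m + 1) : ℝ)).mul (hF (m + 1) z hz))
    have hr := (hF m z hz).const_mul (N - m * (m + 1))
    have he : (fun x => (N - m * (m + 1)) * F m x) =ᶠ[𝓝 z]
        ((fun x : ℝ => x ^ 2 - 1) * F (m + 2) +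
          (fun x => (2 * (m + 1) : ℝ) * id x) * F (m + 1)) := by
      filter_upwards [lt_mem_nhds hz] with x hx
      simpa using (ih x hx).symm
    have := (hl.congr_of_eventuallyEq he).unique hr
    simp only [id] at this
    push_cast
    linear_combination this

theorem legendreD_equation (n m : ℕ) : ∀ z > 1,
    (z ^ 2 - 1) * legendreD n (m + 2) z + 2 * (m + 1) * z * legendreD n (m + 1) z
      = (n * (n + 1) - m * (m + 1)) * legendreD n m z := by
  refine differentiated_legendre_equation (fun m z _ => hasDerivAt_legendreD n m z) ?_ m
  intro z _
  have hp : HasDerivAt (fun x : ℝ => x ^ 2 - 1) (2 * z) z := by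
    simpa using (hasDerivAt_pow 2 z).sub_const 1
  have hl := hp.mul (hasDerivAt_legendreD n 1 z)
  have hr := ((hasDerivAt_legendreD (n + 1) 0 z).sub
    ((hasDerivAt_id z).mul (hasDerivAt_legendreD n 0 z))).const_mul (n + 1 : ℝ)
  have he : ((fun x : ℝ => x ^ 2 - 1) * legendreD n 1) =
      fun x => (n + 1 : ℝ) * (legendreD (n + 1) 0 - id * legendreD n 0 : ℝ → ℝ) x :=
    funext fun x => sq_sub_one_mul_legendreD_one n x
  rw [he] at hl
  have h1 := hl.unique hr
  have h2 := legendreD_succ_succ n 0 z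
  simp only [id, zero_add, Nat.cast_zero] at h1 h2
  linear_combination h1 + (n + 1) * h2

/-- Legendre's equation degenerates at z = 1 to 2 P_n'(1) = n(n+1) P_n(1). It is available only for
z > 1, hence the passage to the limit. -/
theorem legendreD_one_apply_one (n : ℕ) : 2 * legendreD n 1 1 = n * (n + 1) := by
  have h : Tendsto (fun z => (z ^ 2 - 1) * legendreD n 2 z + 2 * z * legendreD n 1 z
      - n * (n + 1) * legendreD n 0 z) (𝓝[>] 1) (𝓝 0) := by
    refine tendsto_const_nhds.congr' ?_
    filter_upwards [self_mem_nhdsWithin] with z hz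
    have := legendreD_equation n 0 z hz
    simp only [Nat.cast_zero, zero_add] at this
    linarith
  have h' : Tendsto (fun z => (z ^ 2 - 1) * legendreD n 2 z + 2 * z * legendreD n 1 z
      - n * (n + 1) * legendreD n 0 z) (𝓝[>] 1) (𝓝 (((1 : ℝ) ^ 2 - 1) * legendreD n 2 1
      + 2 * 1 * legendreD n 1 1 - n * (n + 1) * legendreD n 0 1)) := by
    refine Continuous.tendsto' ?_ _ _ rfl |>.mono_left nhdsWithin_le_nhds
    have h0 := continuous_legendreD n 0
    have h1 := continuous_legendreD n 1
    have h2 := continuous_legendreD n 2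
    fun_prop
  have := tendsto_nhds_unique h h'
  rw [legendreD_zero_apply_one] at this
  linarith

/-- `z f'(z) / f(z)` tends to the degree of the polynomial `f`. -/
theorem tendsto_mul_derivative_div (f : ℝ[X]) (hf : f ≠ 0) :
    Tendsto (fun z => z * (derivative f).eval z / f.eval z) atTop (𝓝 f.natDegree) := by
  by_cases hd : f.natDegree = 0
  · rw [eq_C_of_natDegree_eq_zero hd]
    simp
  · have hne : derivative f ≠ 0 := fun h => hd (derivative_eq_zero.1 h)
    have hnat : (derivative f).natDegree = f.natDegree - 1 :=
      natDegree_derivative _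
    have hdeg : (X * derivative f).degree = f.degree := by
      rw [degree_eq_natDegree (mul_ne_zero X_ne_zero hne), degree_eq_natDegree hf,
        natDegree_X_mul hne, hnat]
      congr 1
      omega
    have := div_tendsto_atTop_leadingCoeff_div_of_degree_eq (X * derivative f) f hdeg
    have hlead : (X * derivative f).leadingCoeff = f.natDegree * f.leadingCoeff := by
      rw [leadingCoeff_mul, leadingCoeff_X, one_mul, leadingCoeff, hnat, coeff_derivative]
      have h1 : f.natDegree - 1 + 1 = f.natDegree := by omega
      rw [h1, leadingCoeff, mul_comm]
      congr 1
      rw [← h1]; push_cast; simp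
    rw [hlead, mul_div_cancel_right₀ _ (leadingCoeff_ne_zero.2 hf)] at this
    simpa using this

theorem natDegree_iterate_derivative_legendreP {n m : ℕ} (hm : m ≤ n) :
    (derivative^[m] (legendreP n)).natDegree = n - m := by
  refine natDegree_eq_of_le_of_coeff_ne_zero ?_ ?_
  · exact (natDegree_iterate_derivative _ _).trans (Nat.sub_le_sub_right (natDegree_legendreP_le n) m)
  · rw [coeff_iterate_derivative, Nat.sub_add_cancel hm]
    have h1 := coeff_legendreP_pos n
    have h2 : 0 < n.descFactorial m := Nat.descFactorial_pos.2 hm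
    rw [nsmul_eq_mul]
    positivity

theorem tendsto_mul_legendreD_div {n m : ℕ} (hm : m ≤ n) :
    Tendsto (fun z => z * legendreD n (m + 1) z / legendreD n m z) atTop (𝓝 ((n : ℝ) - m)) := by
  have hne : derivative^[m] (legendreP n) ≠ 0 := by
    intro h
    have := one_le_legendreD hm le_rfl
    simp [legendreD, h] at this
    linarith
  have := tendsto_mul_derivative_div _ hne
  rw [natDegree_iterate_derivative_legendreP hm, Nat.cast_sub hm] at this
  simpa only [legendreD, Function.iterate_succ_apply'] using this

/-! ### Legendre functions of the second kind -/

/-- Let G = Σ p_n tⁿ and S = 1 - 2zt + t². The recurrence for p says S G' = (z - t) G, whence S G² =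
1. The series of W is I G with I' = G, so S (I G)' = (z - t) I G + S G² = (z - t) I G + 1: the same
equation up to a constant. -/
theorem convolution_three_term {p : ℕ → ℝ} {z : ℝ} (h0 : p 0 = 1) (h1 : p 1 = z)
    (hp : ∀ n : ℕ, (n + 2) * p (n + 2) = (2 * n + 3) * z * p (n + 1) - (n + 1) * p n) {W : ℕ → ℝ}
    (hW : ∀ n, W n = ∑ k ∈ Finset.Icc 1 n, 1 / (k : ℝ) * p (k - 1) * p (n - k)) (n : ℕ) :
    (n + 2) * W (n + 2) = (2 * n + 3) * z * W (n + 1) - (n + 1) * W n := by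
  set G : PowerSeries ℝ := PowerSeries.mk p with hG
  set I : PowerSeries ℝ := PowerSeries.mk fun k => 1 / (k : ℝ) * p (k - 1) with hI
  set S : PowerSeries ℝ := 1 - PowerSeries.C (2 * z) * PowerSeries.X
    + PowerSeries.X * PowerSeries.X with hS
  set d := PowerSeries.derivative ℝ
  have hdI : d I = G := by
    ext k
    rw [PowerSeries.coeff_derivative, hI, hG, PowerSeries.coeff_mk, PowerSeries.coeff_mk]
    push_cast
    field_simp
  have hSd (F : PowerSeries ℝ) : S * F = F - PowerSeries.C (2 * z) * (PowerSeries.X * F)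
    + PowerSeries.X * (PowerSeries.X * F) := by rw [hS]; ring
  have hdG : S * d G = PowerSeries.C z * G - PowerSeries.X * G := by
    rw [hSd]
    ext k
    rcases k with _ | _ | k
    · simp only [map_add, map_sub, PowerSeries.coeff_C_mul, PowerSeries.coeff_zero_X_mul,
        d, PowerSeries.coeff_derivative, hG, PowerSeries.coeff_mk, h0, h1, zero_add]
      simp
    · simp only [map_add, map_sub, PowerSeries.coeff_C_mul, PowerSeries.coeff_succ_X_mul,
        PowerSeries.coeff_zero_X_mul, d, PowerSeries.coeff_derivative, hG, PowerSeries.coeff_mk]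
      have := hp 0
      norm_num at this ⊢
      linarith
    · simp only [map_add, map_sub, PowerSeries.coeff_C_mul, PowerSeries.coeff_succ_X_mul,
        d, PowerSeries.coeff_derivative, hG, PowerSeries.coeff_mk]
      have := hp (k + 1)
      push_cast at this ⊢
      linear_combination this
  have hdS : d S = 2 * PowerSeries.X - PowerSeries.C (2 * z) := by
    simp [hS, d]
    ring
  have hSG : S * (G * G) = 1 := by
    apply PowerSeries.derivative.ext
    · have e1 : d (S * (G * G)) = d S * (G * G) + S * (2 * (G * d G)) := by
        simp [d]
        ring
      have e2 : d 1 = 0 := PowerSeries.derivative_one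
      change d _ = d _
      rw [e1, e2, hdS]
      have e3 : PowerSeries.C (2 * z) = 2 * PowerSeries.C z := by rw [two_mul, map_add, ← two_mul]
      rw [e3]
      linear_combination 2 * G * hdG
    · simp [hS, hG, h0]
  have hdW : S * d (I * G) = PowerSeries.C z * (I * G) - PowerSeries.X * (I * G) + 1 := by
    have e1 : d (I * G) = d I * G + I * d G := by simp [d]; ring
    rw [e1, hdI]
    linear_combination hSG + I * hdG
  have hcoeff (k : ℕ) : PowerSeries.coeff k (I * G) = W k := by
    rw [PowerSeries.coeff_mul, Finset.Nat.sum_antidiagonal_eq_sum_range_succ_mk, hW]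
    simp only [hI, hG, PowerSeries.coeff_mk]
    symm
    refine Finset.sum_subset (fun i hi => ?_) fun i hi hi' => ?_
    · simp only [Finset.mem_Icc, Finset.mem_range] at hi ⊢
      omega
    -- The term k = 0 of I vanishes because 1 / 0 = 0, so I has no constant term.
    · obtain rfl : i = 0 := by
        simp only [Finset.mem_Icc, Finset.mem_range] at hi hi'
        omega
      simp
  -- The inhomogeneous term 1 only affects the coefficient of degree 0, which is not used.
  have := congrArg (PowerSeries.coeff (n + 1)) hdW
  rw [hSd] at this
  simp only [map_add, map_sub, PowerSeries.coeff_C_mul, PowerSeries.coeff_succ_X_mul] at this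
  rcases n with _ | n
  · simp only [PowerSeries.coeff_zero_X_mul, d, PowerSeries.coeff_derivative, hcoeff,
      PowerSeries.coeff_one] at this
    norm_num at this ⊢
    linarith
  · simp only [PowerSeries.coeff_succ_X_mul, d, PowerSeries.coeff_derivative, hcoeff,
      PowerSeries.coeff_one] at this
    norm_num at this ⊢
    linear_combination this

/-- The function `(1 / 2) log ((z + 1) / (z - 1))`. -/
noncomputable def halfLog (z : ℝ) : ℝ := 1 / 2 * Real.log ((z + 1) / (z - 1))

/-- The polynomial part of the Legendre function of the second kind. -/
noncomputable def legendreW (n : ℕ) : ℝ[X] :=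
  ∑ k ∈ Finset.Icc 1 n, C (1 / (k : ℝ)) * legendreP (k - 1) * legendreP (n - k)

theorem sq_sub_one_pos {z : ℝ} (hz : 1 < z) : 0 < z ^ 2 - 1 := by nlinarith

theorem hasDerivAt_sq_sub_one (z : ℝ) : HasDerivAt (fun x : ℝ => x ^ 2 - 1) (2 * z) z := by
  simpa using (hasDerivAt_pow 2 z).sub_const 1

theorem hasDerivAt_halfLog {z : ℝ} (hz : 1 < z) : HasDerivAt halfLog (-1 / (z ^ 2 - 1)) z := by
  have h1 : z - 1 ≠ 0 := by linarith
  have h2 : z + 1 ≠ 0 := by linarith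
  have h3 := (sq_sub_one_pos hz).ne'
  have h := (((hasDerivAt_id z).add_const 1).div ((hasDerivAt_id z).sub_const 1) h1).log
    (div_ne_zero h2 h1)
  refine (h.const_mul (1 / 2)).congr_deriv ?_
  have h4 : z ^ 2 - 1 = (z - 1) * (z + 1) := by ring
  simp only [id, Pi.div_apply]
  rw [h4]
  field_simp
  ring

theorem legendreQ_eq (n : ℕ) (z : ℝ) :
    legendreQ n z = legendreD n 0 z * halfLog z - (legendreW n).eval z := by
  simp only [legendreQ, legendreD, halfLog, legendreW, eval_finsetSum, eval_mul, eval_C,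
    Function.iterate_zero, id]
  ring

theorem legendreQ_three_term (n : ℕ) (z : ℝ) :
    (n + 2) * legendreQ (n + 2) z =
      (2 * n + 3) * z * legendreQ (n + 1) z - (n + 1) * legendreQ n z := by
  have h := convolution_three_term (p := fun n => legendreD n 0 z) (legendreD_zero_left_zero z)
    (legendreD_one_left_zero z) (fun n => legendreD_three_term n z)
    (W := fun n => (legendreW n).eval z)
    (fun n => by simp [legendreW, eval_finsetSum, legendreD]) n
  simp only [legendreQ_eq]
  linear_combination halfLog z * legendreD_three_term n z - h

/-- The `m`-th derivative of the Legendre function of the second kind. -/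
noncomputable def legendreQD (n m : ℕ) : ℝ → ℝ := iteratedDeriv m (legendreQ n)

theorem legendreQD_zero (n : ℕ) : legendreQD n 0 = legendreQ n := iteratedDeriv_zero

theorem analyticAt_legendreQ (n : ℕ) {z : ℝ} (hz : 1 < z) : AnalyticAt ℝ (legendreQ n) z := by
  have hl : AnalyticAt ℝ (fun x : ℝ => Real.log ((x + 1) / (x - 1))) z := by
    refine AnalyticAt.log (AnalyticAt.div (by fun_prop) (by fun_prop) (by linarith)) ?_
    exact div_pos (by linarith) (by linarith)
  have hP (p : ℝ[X]) : AnalyticAt ℝ (fun x : ℝ => p.eval x) z :=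
    AnalyticAt.aeval_polynomial (f := id) analyticAt_id p
  have : legendreQ n = fun z => (legendreP n).eval z * (1 / 2 * Real.log ((z + 1) / (z - 1)))
      - (legendreW n).eval z := funext fun x => legendreQ_eq n x
  rw [this]
  exact ((hP _).mul (analyticAt_const.mul hl)).sub (hP _)

theorem hasDerivAt_legendreQD (n m : ℕ) {z : ℝ} (hz : 1 < z) :
    HasDerivAt (legendreQD n m) (legendreQD n (m + 1) z) z := by
  unfold legendreQD
  rw [iteratedDeriv_succ, iteratedDeriv_eq_iterate]
  exact ((analyticAt_legendreQ n hz).iterated_deriv m).differentiableAt.hasDerivAt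

theorem legendreQ_zero (z : ℝ) : legendreQ 0 z = halfLog z := by
  simp [legendreQ_eq, legendreD_zero_left_zero, legendreW]

theorem legendreQ_one (z : ℝ) : legendreQ 1 z = z * halfLog z - 1 := by
  simp [legendreQ_eq, legendreD_one_left_zero, legendreW, legendreP_zero]

/-- Q_n has no Rodrigues formula here, so both relations are carried together through an induction.
The first at n + 1 is the second at n rewritten by the three-term recurrence; the second follows by
differentiating that recurrence. -/
theorem sq_sub_one_mul_legendreQD_aux {z : ℝ} (hz : 1 < z) (n : ℕ) :
    (z ^ 2 - 1) * legendreQD n 1 z = (n + 1) * (legendreQ (n + 1) z - z * legendreQ n z) ∧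
    (z ^ 2 - 1) * legendreQD (n + 1) 1 z =
      (n + 1) * (z * legendreQ (n + 1) z - legendreQ n z) := by
  have hp := (sq_sub_one_pos hz).ne'
  have hd (n : ℕ) : HasDerivAt (legendreQ n) (legendreQD n 1 z) z := by
    simpa [legendreQD_zero] using hasDerivAt_legendreQD n 0 hz
  induction n with
  | zero =>
    constructor
    · have h := hd 0
      rw [funext legendreQ_zero] at h
      rw [h.unique (hasDerivAt_halfLog hz), legendreQ_zero, legendreQ_one]
      field_simp
      simp
    · have h := hd 1
      rw [funext legendreQ_one] at h
      rw [h.unique (((hasDerivAt_id z).mul (hasDerivAt_halfLog hz)).sub_const 1),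
        legendreQ_zero, legendreQ_one]
      simp only [id]
      field_simp
      simp
      ring
  | succ n ih =>
    obtain ⟨h1, h2⟩ := ih
    have h3 := legendreQ_three_term n z
    constructor
    · rw [h2]
      push_cast
      linear_combination -h3
    · have hl := (hd (n + 2)).const_mul (n + 2 : ℝ)
      have hr := (((hasDerivAt_id z).const_mul (2 * n + 3 : ℝ)).mul (hd (n + 1))).sub
        ((hd n).const_mul (n + 1 : ℝ))
      rw [funext fun x => legendreQ_three_term n x] at hl
      have h4 := hl.unique hr
      simp only [id] at h4
      have hn : (n + 2 : ℝ) ≠ 0 := by positivity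
      apply mul_left_cancel₀ hn
      push_cast
      linear_combination (z ^ 2 - 1) * h4 + (2 * n + 3) * z * h2 - (n + 1) * h1
        - (n + 2) * z * h3

theorem sq_sub_one_mul_legendreQD_one {z : ℝ} (hz : 1 < z) (n : ℕ) :
    (z ^ 2 - 1) * legendreQD n 1 z = (n + 1) * (legendreQ (n + 1) z - z * legendreQ n z) :=
  (sq_sub_one_mul_legendreQD_aux hz n).1

theorem sq_sub_one_mul_legendreQD_succ_one {z : ℝ} (hz : 1 < z) (n : ℕ) :
    (z ^ 2 - 1) * legendreQD (n + 1) 1 z =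
      (n + 1) * (z * legendreQ (n + 1) z - legendreQ n z) :=
  (sq_sub_one_mul_legendreQD_aux hz n).2

theorem legendreQD_equation (n m : ℕ) : ∀ z > 1,
    (z ^ 2 - 1) * legendreQD n (m + 2) z + 2 * (m + 1) * z * legendreQD n (m + 1) z
      = (n * (n + 1) - m * (m + 1)) * legendreQD n m z := by
  refine differentiated_legendre_equation (fun m z hz => hasDerivAt_legendreQD n m hz) ?_ m
  intro z hz
  have hp := (sq_sub_one_pos hz).ne'
  have hl := (hasDerivAt_sq_sub_one z).mul (hasDerivAt_legendreQD n 1 hz)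
  have hr := ((hasDerivAt_legendreQD (n + 1) 0 hz).sub
    ((hasDerivAt_id z).mul (hasDerivAt_legendreQD n 0 hz))).const_mul (n + 1 : ℝ)
  have he : (fun x => (n + 1 : ℝ) * (legendreQD (n + 1) 0 - id * legendreQD n 0 : ℝ → ℝ) x)
      =ᶠ[𝓝 z] ((fun x : ℝ => x ^ 2 - 1) * legendreQD n 1) := by
    filter_upwards [lt_mem_nhds hz] with x hx
    simpa [legendreQD_zero] using (sq_sub_one_mul_legendreQD_one hx n).symm
  have h1 := (hl.congr_of_eventuallyEq he).unique hr
  have h2 : legendreQD (n + 1) 1 z = z * legendreQD n 1 z + (n + 1) * legendreQ n z := by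
    apply mul_left_cancel₀ hp
    linear_combination sq_sub_one_mul_legendreQD_succ_one hz n
      - z * sq_sub_one_mul_legendreQD_one hz n
  simp only [id, zero_add, legendreQD_zero] at h1 ⊢
  linear_combination h1 + (n + 1) * h2

/-- The expressions for n and n + 1 both equal (n+1)(P_{n+1} Q_n - P_n Q_{n+1}), so the value does
not depend on n. -/
theorem wronskian_zero {z : ℝ} (hz : 1 < z) (n : ℕ) :
    (z ^ 2 - 1) * (legendreD n 1 z * legendreQ n z - legendreD n 0 z * legendreQD n 1 z) = 1 := by
  induction n with
  | zero =>
    have h1 := sq_sub_one_mul_legendreD_one 0 z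
    have h2 := sq_sub_one_mul_legendreQD_one hz 0
    rw [legendreD_zero_left_zero, zero_add, legendreD_one_left_zero] at h1
    rw [zero_add, legendreQ_one, legendreQ_zero] at h2
    rw [legendreD_zero_left_zero, legendreQ_zero]
    push_cast at h1 h2
    linear_combination halfLog z * h1 - h2
  | succ n ih =>
    have h1 := sq_sub_one_mul_legendreD_one n z
    have h2 := sq_sub_one_mul_legendreQD_one hz n
    have h3 := sq_sub_one_mul_legendreD_succ_one n z
    have h4 := sq_sub_one_mul_legendreQD_succ_one hz n
    linear_combination ih + legendreQ (n + 1) z * h3 - legendreD (n + 1) 0 z * h4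
      - legendreQ n z * h1 + legendreD n 0 z * h2

/-- In the equations for the m-th derivatives the middle terms cancel, so each step multiplies the
Wronskian by -(n-m)(n+m+1)/(z² - 1), with n(n+1) - m(m+1) = (n-m)(n+m+1). -/
theorem wronskian {z : ℝ} (hz : 1 < z) {n m : ℕ} (hm : m ≤ n) :
    (z ^ 2 - 1) ^ (m + 1) * (legendreD n (m + 1) z * legendreQD n m z
      - legendreD n m z * legendreQD n (m + 1) z) * ((n - m).factorial : ℝ)
      = (-1) ^ m * ((n + m).factorial : ℝ) := by
  induction m with
  | zero =>
    have := wronskian_zero hz n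
    simp only [zero_add, legendreQD_zero, Nat.sub_zero, add_zero, pow_one, pow_zero, this]
  | succ m ih =>
    have h := ih (by omega)
    have h1 := legendreD_equation n m z hz
    have h2 := legendreQD_equation n m z hz
    have h3 : n - m = (n - (m + 1)) + 1 := by omega
    have h4 : ((n - (m + 1) : ℕ) : ℝ) = n - m - 1 := by
      rw [Nat.cast_sub hm]; push_cast; ring
    rw [h3, Nat.factorial_succ] at h
    rw [← add_assoc, Nat.factorial_succ]
    push_cast at h ⊢
    rw [h4] at h
    set f : ℝ := ((n - (m + 1)).factorial : ℝ)
    linear_combination (z ^ 2 - 1) ^ (m + 1) * f * legendreQD n (m + 1) z * h1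
      - (z ^ 2 - 1) ^ (m + 1) * f * legendreD n (m + 1) z * h2 - (n + m + 1) * h

/-! ### Behaviour of Q_n at infinity and of the logarithm at 1. -/

theorem degree_legendreW_lt (n : ℕ) : (legendreW n).degree < n := by
  rw [← mem_degreeLT]
  refine Submodule.sum_mem _ fun k hk => ?_
  rw [Finset.mem_Icc] at hk
  rw [mem_degreeLT]
  have h : (C (1 / (k : ℝ)) * legendreP (k - 1) * legendreP (n - k)).natDegree ≤ n - 1 := by
    refine natDegree_mul_le.trans ?_
    have h1 := (natDegree_C_mul_le (1 / (k : ℝ)) (legendreP (k - 1))).trans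
      (natDegree_legendreP_le _)
    have h2 := natDegree_legendreP_le (n - k)
    omega
  refine lt_of_le_of_lt (degree_le_of_natDegree_le h) ?_
  exact_mod_cast (show n - 1 < n by omega)

theorem tendsto_halfLog_atTop : Tendsto halfLog atTop (𝓝 0) := by
  have h := div_tendsto_atTop_leadingCoeff_div_of_degree_eq (X + C 1 : ℝ[X]) (X - C 1)
    (by rw [degree_X_add_C, degree_X_sub_C])
  have h' : Tendsto (fun z : ℝ => (z + 1) / (z - 1)) atTop (𝓝 1) := by
    rw [leadingCoeff_X_add_C, leadingCoeff_X_sub_C, div_one] at h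
    simpa using h
  have := (h'.log one_ne_zero).const_mul (1 / 2)
  rwa [Real.log_one, mul_zero] at this

/-- The quotient is `halfLog` minus W_n/P_n, and each part tends to 0 separately. This crude decay
is enough: the Wronskian recovers the exact rate in `tendsto_mul_of_wronskian`. -/
theorem tendsto_legendreQ_div_atTop (n : ℕ) :
    Tendsto (fun z => legendreQ n z / legendreD n 0 z) atTop (𝓝 0) := by
  have hdeg : (legendreP n).degree = n := by
    have h := natDegree_iterate_derivative_legendreP (Nat.zero_le n)
    rw [Function.iterate_zero, id] at h
    rw [degree_eq_natDegree, h, Nat.sub_zero]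
    intro h0
    have := coeff_legendreP_pos n
    simp [h0] at this
  have h := div_tendsto_atTop_zero_of_degree_lt (legendreW n) (legendreP n)
    (by rw [hdeg]; exact degree_legendreW_lt n)
  have := tendsto_halfLog_atTop.sub h
  rw [sub_zero] at this
  refine this.congr' ?_
  filter_upwards [eventually_ge_atTop 1] with z hz
  have h1 := one_le_legendreD (Nat.zero_le n) hz
  have h2 : legendreD n 0 z ≠ 0 := by linarith
  rw [legendreQ_eq, sub_div, mul_div_cancel_left₀ _ h2]
  rfl

theorem tendsto_sq_sub_one_mul_halfLog :
    Tendsto (fun z => (z ^ 2 - 1) * halfLog z) (𝓝[>] 1) (𝓝 0) := by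
  have h1 : Tendsto (fun z : ℝ => (z - 1) * Real.log (z - 1)) (𝓝[>] 1) (𝓝 0) := by
    have : Continuous fun z : ℝ => (z - 1) * Real.log (z - 1) :=
      Real.continuous_mul_log.comp (continuous_id.sub continuous_const)
    exact (this.tendsto' 1 0 (by simp)).mono_left nhdsWithin_le_nhds
  have h2 : Tendsto (fun z : ℝ => (z ^ 2 - 1) * Real.log (z + 1)) (𝓝[>] 1) (𝓝 0) := by
    have : ContinuousAt (fun z : ℝ => (z ^ 2 - 1) * Real.log (z + 1)) 1 := by
      have : (1 : ℝ) + 1 ≠ 0 := by norm_num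
      fun_prop (disch := assumption)
    have h := this.tendsto
    norm_num at h
    exact h.mono_left nhdsWithin_le_nhds
  have h3 : Tendsto (fun z : ℝ => z + 1) (𝓝[>] 1) (𝓝 2) :=
    ((continuous_add_const 1).tendsto' 1 2 (by norm_num)).mono_left nhdsWithin_le_nhds
  have := (h2.sub (h3.mul h1)).const_mul (1 / 2)
  norm_num at this
  refine this.congr' ?_
  filter_upwards [self_mem_nhdsWithin] with z hz
  have hz : 1 < z := hz
  rw [halfLog, Real.log_div (by linarith) (by linarith)]
  ring

/-! ### Pairs of recessive and dominant solutions of the associated Legendre equation -/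

theorem pos_of_deriv_neg_of_tendsto_zero {f f' : ℝ → ℝ} {a : ℝ}
    (hf : ∀ z > a, HasDerivAt f (f' z) z) (hf' : ∀ z > a, f' z < 0)
    (ht : Tendsto f atTop (𝓝 0)) {z : ℝ} (hz : a < z) : 0 < f z := by
  have hanti : StrictAntiOn f (Set.Ioi a) := by
    refine strictAntiOn_of_deriv_neg (convex_Ioi a)
      (fun x hx => (hf x hx).continuousAt.continuousWithinAt) fun x hx => ?_
    rw [interior_Ioi] at hx
    rw [(hf x hx).deriv]
    exact hf' x hx
  have h1 : f (z + 1) < f z := hanti hz (show a < z + 1 by linarith) (by linarith)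
  have h2 : 0 ≤ f (z + 1) := by
    refine le_of_tendsto ht ?_
    filter_upwards [eventually_ge_atTop (z + 1)] with x hx
    exact hanti.antitoneOn (show a < z + 1 by linarith) (show a < x by linarith) hx
  linarith

/-- A function that increases wherever it is nonnegative and tends to zero at infinity is
negative. -/
theorem neg_of_deriv_pos_of_tendsto_zero {g g' : ℝ → ℝ} {a : ℝ}
    (hg : ∀ z > a, HasDerivAt g (g' z) z) (hg' : ∀ z > a, 0 ≤ g z → 0 < g' z)
    (ht : Tendsto g atTop (𝓝 0)) {z : ℝ} (hz : a < z) : g z < 0 := by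
  by_contra! h0
  -- Once nonnegative, g cannot cross 0 downwards. It then increases strictly from z on, which is
  -- incompatible with the limit 0.
  have hnn : ∀ x ≥ z, 0 ≤ g x := by
    intro x hx
    have := image_le_of_deriv_right_lt_deriv_boundary' (f := fun t => -g t) (f' := fun t => -g' t)
      (a := z) (b := x) (B := fun _ => 0) (B' := fun _ => 0)
      (fun t ht => (hg t (hz.trans_le ht.1)).continuousAt.neg.continuousWithinAt)
      (fun t ht => (hg t (hz.trans_le ht.1)).neg.hasDerivWithinAt) (by simpa using h0)
      continuousOn_const (fun t _ => hasDerivWithinAt_const _ _ _)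
      (fun t ht h => by
        have := hg' t (hz.trans_le ht.1) (by linarith [show -g t = 0 from h])
        linarith)
      (show x ∈ Set.Icc z x from ⟨hx, le_rfl⟩)
    linarith [show -g x ≤ 0 from this]
  have hmono : StrictMonoOn g (Set.Ici z) := by
    refine strictMonoOn_of_deriv_pos (convex_Ici z)
      (fun x hx => (hg x (hz.trans_le hx)).continuousAt.continuousWithinAt) fun x hx => ?_
    rw [interior_Ici] at hx
    rw [(hg x (hz.trans hx)).deriv]
    exact hg' x (hz.trans hx) (hnn x (le_of_lt hx))
  have h1 : g z < g (z + 1) :=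
    hmono (show z ≤ z by rfl) (show z ≤ z + 1 by linarith) (by linarith)
  have h2 : g (z + 1) ≤ 0 := by
    refine ge_of_tendsto ht ?_
    filter_upwards [eventually_ge_atTop (z + 1)] with x hx
    exact hmono.monotoneOn (show z ≤ z + 1 by linarith) (show z ≤ x by linarith) hx
  linarith

/-- A function on `(a, ∞)` that decreases wherever it is nonnegative and tends to zero at the left
end point is negative. -/
theorem neg_of_deriv_neg_of_tendsto_zero_left {f f' : ℝ → ℝ} {a : ℝ}
    (hf : ∀ z > a, HasDerivAt f (f' z) z) (hf' : ∀ z > a, 0 ≤ f z → f' z < 0)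
    (ht : Tendsto f (𝓝[>] a) (𝓝 0)) {z : ℝ} (hz : a < z) : f z < 0 := by
  have hgt : ∀ t > (0 : ℝ), a < a + t⁻¹ := fun t ht => by
    have := inv_pos.2 ht
    linarith
  -- The substitution z = a + 1/t exchanges the left end point with infinity and reverses the sign
  -- of the derivative.
  have h := neg_of_deriv_pos_of_tendsto_zero (g := fun t => f (a + t⁻¹))
    (g' := fun t => f' (a + t⁻¹) * (-(t ^ 2)⁻¹)) (a := 0) (z := (z - a)⁻¹)
    (fun t ht => (hf _ (hgt t ht)).comp t ((hasDerivAt_inv ht.ne').const_add a))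
    (fun t ht h0 => by
      have h1 := hf' _ (hgt t ht) h0
      have h2 : 0 < (t ^ 2)⁻¹ := by positivity
      nlinarith)
    (ht.comp (tendsto_nhdsWithin_iff.2 ⟨by simpa using tendsto_inv_atTop_zero.const_add a, by
      filter_upwards [eventually_gt_atTop 0] with t ht using hgt t ht⟩))
    (inv_pos.2 (sub_pos.2 hz))
  simpa using h

/-- If `A = (z² - 1) u'`, `B = (z² - 1) v'` with `A v - u B = 1`, and `v` is recessive, then the
growth exponent `κ` of `u` determines the asymptotics of `u v`. -/
theorem tendsto_mul_of_wronskian {u A v B : ℝ → ℝ} {κ : ℝ} (hκ : 0 ≤ κ)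
    (hu : ∀ z > 1, HasDerivAt u (A z / (z ^ 2 - 1)) z)
    (hv : ∀ z > 1, HasDerivAt v (B z / (z ^ 2 - 1)) z)
    (hW : ∀ z > 1, A z * v z - u z * B z = 1)
    (hpos : ∀ z > 1, 0 < u z) (hA : ∀ z > 1, 0 ≤ A z)
    (htop : Tendsto (fun z => z * u z ^ 2) atTop atTop)
    (hratio : Tendsto (fun z => v z / u z) atTop (𝓝 0))
    (hexp : Tendsto (fun z => A z / (z * u z)) atTop (𝓝 κ)) :
    Tendsto (fun z => z * (u z * v z)) atTop (𝓝 (1 / (2 * κ + 1))) := by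
  have hev : ∀ᶠ z : ℝ in atTop, 1 < z := eventually_gt_atTop 1
  -- Here z u v = (v/u)/(1/(z u²)) is a quotient of two functions tending to 0, and (v/u)' = -1/((z²
  -- - 1) u²) by the Wronskian. The quotient of derivatives is 1/(2A/(zu) + 1 - 1/z²).
  have key : Tendsto (fun z => (v z / u z) / (z * u z ^ 2)⁻¹) atTop (𝓝 (1 / (2 * κ + 1))) := by
    refine HasDerivAt.lhopital_zero_atTop (f' := fun z => -1 / ((z ^ 2 - 1) * u z ^ 2))
      (g' := fun z => -(u z ^ 2 + z * (2 * u z * (A z / (z ^ 2 - 1)))) / (z * u z ^ 2) ^ 2)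
      ?_ ?_ ?_ hratio (tendsto_inv_atTop_zero.comp htop) ?_
    · filter_upwards [hev] with z hz
      have h1 := (sq_sub_one_pos hz).ne'
      have h2 := (hpos z hz).ne'
      refine ((hv z hz).div (hu z hz) h2).congr_deriv ?_
      field_simp
      linear_combination - hW z hz
    · filter_upwards [hev] with z hz
      have h2 := (hpos z hz).ne'
      have h3 : z ≠ 0 := by linarith
      have h := ((hasDerivAt_id z).mul ((hu z hz).pow 2)).inv (mul_ne_zero h3 (pow_ne_zero 2 h2))
      refine h.congr_deriv ?_
      simp
    · filter_upwards [hev] with z hz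
      have h1 := sq_sub_one_pos hz
      have h2 := hpos z hz
      have h3 : 0 < z := by linarith
      have h4 := hA z hz
      have : 0 < (u z ^ 2 + z * (2 * u z * (A z / (z ^ 2 - 1)))) / (z * u z ^ 2) ^ 2 := by
        positivity
      rw [neg_div]
      linarith
    · have e1 : Tendsto (fun z : ℝ => 1 - (z ^ 2)⁻¹) atTop (𝓝 (1 - 0)) :=
        tendsto_const_nhds.sub (tendsto_inv_atTop_zero.comp (tendsto_pow_atTop two_ne_zero))
      have e2 := (tendsto_const_nhds (x := (1 : ℝ))).div ((hexp.const_mul 2).add e1)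
        (by linarith)
      rw [sub_zero] at e2
      refine e2.congr' ?_
      filter_upwards [hev] with z hz
      have h1 := sq_sub_one_pos hz
      have h2 := hpos z hz
      have h3 : 0 < z := by linarith
      have h4 := hA z hz
      have h5 : 2 * (A z / (z * u z)) + (1 - (z ^ 2)⁻¹)
          = (2 * z * A z + (z ^ 2 - 1) * u z) / (z ^ 2 * u z) := by
        field_simp
      have h6 : u z ^ 2 + z * (2 * u z * (A z / (z ^ 2 - 1)))
          = u z * (2 * z * A z + (z ^ 2 - 1) * u z) / (z ^ 2 - 1) := by
        field_simp
        ring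
      have h7 : 0 < 2 * z * A z + (z ^ 2 - 1) * u z := by positivity
      simp only [Pi.div_apply]
      rw [h5, h6]
      field_simp
  refine key.congr' ?_
  filter_upwards [hev] with z hz
  have h2 := (hpos z hz).ne'
  field_simp

/-- The square root of `(z² - 1)` times the potential of the associated Legendre equation. -/
noncomputable def charRoot (n m : ℕ) (z : ℝ) : ℝ := √(n * (n + 1) * (z ^ 2 - 1) + m ^ 2)

theorem charRoot_radicand_pos {n m : ℕ} (hn : 1 ≤ n) {z : ℝ} (hz : 1 < z) :
    (0 : ℝ) < n * (n + 1) * (z ^ 2 - 1) + m ^ 2 := by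
  have := sq_sub_one_pos hz
  have : (0 : ℝ) < n := by exact_mod_cast hn
  positivity

theorem charRoot_pos {n m : ℕ} (hn : 1 ≤ n) {z : ℝ} (hz : 1 < z) : 0 < charRoot n m z :=
  Real.sqrt_pos.2 (charRoot_radicand_pos hn hz)

theorem charRoot_sq {n m : ℕ} (hn : 1 ≤ n) {z : ℝ} (hz : 1 < z) :
    charRoot n m z ^ 2 = n * (n + 1) * (z ^ 2 - 1) + m ^ 2 :=
  Real.sq_sqrt (charRoot_radicand_pos hn hz).le

theorem continuous_charRoot (n m : ℕ) : Continuous (charRoot n m) := by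
  unfold charRoot
  fun_prop

theorem hasDerivAt_charRoot {n m : ℕ} (hn : 1 ≤ n) {z : ℝ} (hz : 1 < z) :
    HasDerivAt (charRoot n m) (n * (n + 1) * z / charRoot n m z) z := by
  have h := (((hasDerivAt_sq_sub_one z).const_mul (n * (n + 1) : ℝ)).add_const
    ((m : ℝ) ^ 2)).sqrt (charRoot_radicand_pos hn hz).ne'
  refine h.congr_deriv ?_
  have := charRoot_pos (m := m) hn hz
  rw [charRoot] at this ⊢
  field_simp

theorem tendsto_charRoot_div (n m : ℕ) :
    Tendsto (fun z => charRoot n m z / z) atTop (𝓝 √(n * (n + 1))) := by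
  have h : Tendsto (fun z : ℝ => (n * (n + 1) : ℝ) + (m ^ 2 - n * (n + 1)) * (z ^ 2)⁻¹) atTop
      (𝓝 ((n * (n + 1) : ℝ) + (m ^ 2 - n * (n + 1)) * 0)) :=
    tendsto_const_nhds.add
      ((tendsto_inv_atTop_zero.comp (tendsto_pow_atTop two_ne_zero)).const_mul _)
  rw [mul_zero, add_zero] at h
  refine h.sqrt.congr' ?_
  filter_upwards [eventually_gt_atTop 0] with z hz
  rw [charRoot]
  nth_rewrite 3 [← Real.sqrt_sq hz.le]
  rw [← Real.sqrt_div' _ (sq_nonneg z)]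
  congr 1
  field_simp
  ring

/-- `u` and `v` solve the associated Legendre equation of degree `n` and order `m` on `(1, ∞)`,
with `A = (z² - 1) u'` and `B = (z² - 1) v'`; `u` is regular at `1` and `v` is recessive at `∞`,
normalized by their Wronskian. -/
structure SolutionPair (n m : ℕ) (u A v B : ℝ → ℝ) : Prop where
  hasDerivAt_u : ∀ z > 1, HasDerivAt u (A z / (z ^ 2 - 1)) z
  hasDerivAt_A : ∀ z > 1, HasDerivAt A ((n * (n + 1) + m ^ 2 / (z ^ 2 - 1)) * u z) z
  hasDerivAt_v : ∀ z > 1, HasDerivAt v (B z / (z ^ 2 - 1)) z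
  hasDerivAt_B : ∀ z > 1, HasDerivAt B ((n * (n + 1) + m ^ 2 / (z ^ 2 - 1)) * v z) z
  wronskian : ∀ z > 1, A z * v z - u z * B z = 1
  u_pos : ∀ z > 1, 0 < u z
  A_pos : ∀ z > 1, 0 < A z
  tendsto_mul : Tendsto (fun z => z * (u z * v z)) atTop (𝓝 (1 / (2 * n + 1)))
  tendsto_u : Tendsto u atTop atTop
  tendsto_exponent : Tendsto (fun z => A z / (z * u z)) atTop (𝓝 n)
  tendsto_ratio : Tendsto (fun z => v z / u z) atTop (𝓝 0)
  tendsto_boundary : Tendsto (fun z => A z - charRoot n m z * u z) (𝓝[>] 1) (𝓝 0)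

/-! ### Comparison estimates for a solution pair. -/

namespace SolutionPair

variable {n m : ℕ} {u A v B : ℝ → ℝ}

theorem hasDerivAt_ratio (h : SolutionPair n m u A v B) {z : ℝ} (hz : 1 < z) :
    HasDerivAt (fun z => v z / u z) (-1 / ((z ^ 2 - 1) * u z ^ 2)) z := by
  have h1 := (sq_sub_one_pos hz).ne'
  have h2 := (h.u_pos z hz).ne'
  refine ((h.hasDerivAt_v z hz).div (h.hasDerivAt_u z hz) h2).congr_deriv ?_
  field_simp
  linear_combination - h.wronskian z hz

theorem v_pos (h : SolutionPair n m u A v B) {z : ℝ} (hz : 1 < z) : 0 < v z := by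
  have := pos_of_deriv_neg_of_tendsto_zero (fun z hz => h.hasDerivAt_ratio hz) (fun z hz => by
    have h1 := sq_sub_one_pos hz
    have h2 := h.u_pos z hz
    rw [neg_div]
    have : 0 < 1 / ((z ^ 2 - 1) * u z ^ 2) := by positivity
    linarith) h.tendsto_ratio hz
  exact (div_pos_iff_of_pos_right (h.u_pos z hz)).1 this

theorem tendsto_A_mul_v (h : SolutionPair n m u A v B) :
    Tendsto (fun z => A z * v z) atTop (𝓝 (n / (2 * n + 1))) := by
  have := h.tendsto_exponent.mul h.tendsto_mul
  rw [mul_one_div] at this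
  refine this.congr' ?_
  filter_upwards [eventually_gt_atTop 1] with z hz
  have h2 := (h.u_pos z hz).ne'
  have h3 : z ≠ 0 := by linarith
  field_simp

/-- With q = `charRoot`, the difference D = A - q u satisfies D' = -(q/(z² - 1)) D - q' u, and q' >
0. So D decreases wherever it is nonnegative, and it starts from 0 at z = 1. -/
theorem A_lt (h : SolutionPair n m u A v B) (hn : 1 ≤ n) {z : ℝ} (hz : 1 < z) :
    A z < charRoot n m z * u z := by
  have := neg_of_deriv_neg_of_tendsto_zero_left (fun z hz => (h.hasDerivAt_A z hz).sub
    ((hasDerivAt_charRoot (m := m) hn hz).mul (h.hasDerivAt_u z hz))) (fun z hz h0 => ?_)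
    h.tendsto_boundary hz
  · simpa using this
  · have h1 := sq_sub_one_pos hz
    have h2 := h.u_pos z hz
    have h3 := charRoot_pos (m := m) hn hz
    have h4 := charRoot_sq (m := m) hn hz
    have hn' : (0 : ℝ) < n := by exact_mod_cast hn
    have hz0 : 0 < z := by linarith
    have h5 : (n * (n + 1) + m ^ 2 / (z ^ 2 - 1)) = charRoot n m z ^ 2 / (z ^ 2 - 1) := by
      rw [h4]; field_simp
    have h0' : 0 ≤ A z - charRoot n m z * u z := h0
    have h6 : 0 ≤ charRoot n m z / (z ^ 2 - 1) * (A z - charRoot n m z * u z) := by positivity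
    have h7 : 0 < n * (n + 1) * z / charRoot n m z * u z := by positivity
    rw [h5]
    have h8 : charRoot n m z ^ 2 / (z ^ 2 - 1) * u z - (n * (n + 1) * z / charRoot n m z * u z
        + charRoot n m z * (A z / (z ^ 2 - 1)))
        = -(charRoot n m z / (z ^ 2 - 1) * (A z - charRoot n m z * u z))
          - n * (n + 1) * z / charRoot n m z * u z := by ring
    rw [h8]
    linarith

/-- The mirror image at infinity: E = B + q v satisfies E' = (q/(z² - 1)) E + q' v and tends to 0,
since B = (A v - 1)/u and q v = (q/z)(z u v)/u. -/
theorem B_lt (h : SolutionPair n m u A v B) (hn : 1 ≤ n) {z : ℝ} (hz : 1 < z) :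
    B z < -(charRoot n m z * v z) := by
  have hinv : Tendsto (fun z => (u z)⁻¹) atTop (𝓝 0) := tendsto_inv_atTop_zero.comp h.tendsto_u
  have hlim : Tendsto (fun z => B z + charRoot n m z * v z) atTop (𝓝 0) := by
    have e1 := (h.tendsto_A_mul_v.sub_const 1).mul hinv
    have e2 := ((tendsto_charRoot_div n m).mul h.tendsto_mul).mul hinv
    have e3 := e1.add e2
    rw [mul_zero, mul_zero, add_zero] at e3
    refine e3.congr' ?_
    filter_upwards [eventually_gt_atTop 1] with z hz
    have h2 := (h.u_pos z hz).ne'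
    have h3 : z ≠ 0 := by linarith
    have h4 : A z * v z - 1 = u z * B z := by linarith [h.wronskian z hz]
    rw [h4]
    field_simp
  have := neg_of_deriv_pos_of_tendsto_zero (fun z hz => (h.hasDerivAt_B z hz).add
    ((hasDerivAt_charRoot (m := m) hn hz).mul (h.hasDerivAt_v z hz))) (fun z hz h0 => ?_)
    hlim hz
  · have h' : B z + charRoot n m z * v z < 0 := this
    linarith
  · have h1 := sq_sub_one_pos hz
    have h2 := h.v_pos hz
    have h3 := charRoot_pos (m := m) hn hz
    have h4 := charRoot_sq (m := m) hn hz
    have hn' : (0 : ℝ) < n := by exact_mod_cast hn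
    have hz0 : 0 < z := by linarith
    have h5 : (n * (n + 1) + m ^ 2 / (z ^ 2 - 1)) = charRoot n m z ^ 2 / (z ^ 2 - 1) := by
      rw [h4]; field_simp
    have h0' : 0 ≤ B z + charRoot n m z * v z := h0
    have h6 : 0 ≤ charRoot n m z / (z ^ 2 - 1) * (B z + charRoot n m z * v z) := by positivity
    have h7 : 0 < n * (n + 1) * z / charRoot n m z * v z := by positivity
    rw [h5]
    have h8 : charRoot n m z ^ 2 / (z ^ 2 - 1) * v z + (n * (n + 1) * z / charRoot n m z * v z
        + charRoot n m z * (B z / (z ^ 2 - 1)))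
        = charRoot n m z / (z ^ 2 - 1) * (B z + charRoot n m z * v z)
          + n * (n + 1) * z / charRoot n m z * v z := by ring
    rw [h8]
    linarith

theorem A_mul_v_pos (h : SolutionPair n m u A v B) {z : ℝ} (hz : 1 < z) : 0 < A z * v z :=
  mul_pos (h.A_pos z hz) (h.v_pos hz)

theorem A_mul_v_lt (h : SolutionPair n m u A v B) (hn : 1 ≤ n) {z : ℝ} (hz : 1 < z) :
    A z * v z < 1 / 2 := by
  have h1 := mul_lt_mul_of_pos_right (h.A_lt hn hz) (h.v_pos hz)
  have h2 := mul_lt_mul_of_pos_left (h.B_lt hn hz) (h.u_pos z hz)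
  have h3 := h.wronskian z hz
  nlinarith

/-- q u v < -u B = 1 - A v < 1. As q grows with n, this makes u v small for large n. -/
theorem charRoot_mul_lt_one (h : SolutionPair n m u A v B) (hn : 1 ≤ n) {z : ℝ} (hz : 1 < z) :
    charRoot n m z * (u z * v z) < 1 := by
  have h1 := h.A_mul_v_pos hz
  have h2 := mul_lt_mul_of_pos_left (h.B_lt hn hz) (h.u_pos z hz)
  have h3 := h.wronskian z hz
  nlinarith

theorem continuousOn_A_mul_v (h : SolutionPair n m u A v B) :
    ContinuousOn (fun z => A z * v z) (Set.Ioi 1) := fun z hz =>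
  ((h.hasDerivAt_A z hz).continuousAt.mul
    (h.hasDerivAt_v z hz).continuousAt).continuousWithinAt

/-- A second-order bound on `A` at infinity forces `A v` below its limit. -/
theorem exists_A_mul_v_lt (h : SolutionPair n m u A v B) (hn : 1 ≤ n)
    (hA : ∀ᶠ z in atTop, (n + 1) * A z ^ 2 < n * charRoot n m z ^ 2 * u z ^ 2) :
    ∃ z > 1, A z * v z < n / (2 * n + 1) := by
  obtain ⟨a, ha⟩ := eventually_atTop.1 (hA.and (eventually_gt_atTop 1))
  have ha' : ∀ z > a, 1 < z := fun z hz => (ha z (le_of_lt hz)).2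
  have hn' : (0 : ℝ) < n := by exact_mod_cast hn
  have htop : Tendsto (fun z => A z * u z) atTop atTop := by
    have h2 : Tendsto (fun z : ℝ => A z / (z * u z) * (z * (u z * u z))) atTop atTop :=
      h.tendsto_exponent.pos_mul_atTop hn'
        (tendsto_id.atTop_mul_atTop₀ (h.tendsto_u.atTop_mul_atTop₀ h.tendsto_u))
    refine h2.congr' ?_
    filter_upwards [eventually_gt_atTop 1] with z hz
    have h2 := (h.u_pos z hz).ne'
    have h3 : z ≠ 0 := by linarith
    field_simp
  have hlim : Tendsto (fun z => n / (2 * n + 1) * (A z * u z)⁻¹ - v z / u z) atTop (𝓝 0) := by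
    simpa using ((tendsto_inv_atTop_zero.comp htop).const_mul (n / (2 * n + 1 : ℝ))).sub
      h.tendsto_ratio
  -- With c = n/(2n+1), A v < c is equivalent to c/(A u) - v/u > 0. This difference tends to 0, and
  -- (A u)' = (q² u² + A²)/(z² - 1) turns the hypothesis into the negativity of its derivative.
  have hd : ∀ z > a, HasDerivAt (fun z => n / (2 * n + 1) * (A z * u z)⁻¹ - v z / u z)
      (((n + 1) * A z ^ 2 - n * charRoot n m z ^ 2 * u z ^ 2)
        / ((2 * n + 1) * (z ^ 2 - 1) * (A z * u z) ^ 2)) z := by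
    intro z hz
    have hz := ha' z hz
    have h1 := (sq_sub_one_pos hz).ne'
    have h2 := (h.u_pos z hz).ne'
    have h3 := (h.A_pos z hz).ne'
    have h4 := ((((h.hasDerivAt_A z hz).mul (h.hasDerivAt_u z hz)).inv
      (mul_ne_zero h3 h2)).const_mul (n / (2 * n + 1 : ℝ))).sub (h.hasDerivAt_ratio hz)
    refine h4.congr_deriv ?_
    have h5 : (2 * n + 1 : ℝ) ≠ 0 := by positivity
    rw [charRoot_sq hn hz]
    simp only [Pi.mul_apply]
    field_simp
    ring
  have hneg : ∀ z > a, ((n + 1) * A z ^ 2 - n * charRoot n m z ^ 2 * u z ^ 2)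
        / ((2 * n + 1) * (z ^ 2 - 1) * (A z * u z) ^ 2) < 0 := by
    intro z hz
    have h0 := (ha z (le_of_lt hz)).1
    have hz := ha' z hz
    have h1 := sq_sub_one_pos hz
    have h2 := h.u_pos z hz
    have h3 := h.A_pos z hz
    exact div_neg_of_neg_of_pos (by linarith) (by positivity)
  have hz := ha' (a + 1) (by linarith)
  refine ⟨a + 1, hz, ?_⟩
  have := pos_of_deriv_neg_of_tendsto_zero hd hneg hlim (show a < a + 1 by linarith)
  have h2 := h.u_pos _ hz
  have h3 := h.A_pos _ hz
  have h4 := mul_pos this (mul_pos h3 h2)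
  have h5 : (n / (2 * n + 1) * (A (a + 1) * u (a + 1))⁻¹ - v (a + 1) / u (a + 1))
      * (A (a + 1) * u (a + 1)) = n / (2 * n + 1) - A (a + 1) * v (a + 1) := by
    field_simp
  linarith

end SolutionPair

/-! ### Associated Legendre functions -/

theorem hasDerivAt_sqrt_pow (m : ℕ) {z : ℝ} (hz : 1 < z) :
    HasDerivAt (fun x : ℝ => √(x ^ 2 - 1) ^ m) (√(z ^ 2 - 1) ^ m * (m * z / (z ^ 2 - 1))) z := by
  have hp := sq_sub_one_pos hz
  have h := ((hasDerivAt_sq_sub_one z).sqrt hp.ne').pow m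
  refine h.congr_deriv ?_
  have hs := Real.sqrt_pos.2 hp
  cases m with
  | zero => simp
  | succ m =>
    have h2 : z ^ 2 - 1 = √(z ^ 2 - 1) ^ 2 := (Real.sq_sqrt hp.le).symm
    set s := √(z ^ 2 - 1)
    rw [h2, Nat.add_sub_cancel, pow_succ]
    field_simp

/-- The function `(z² - 1)^{m/2} F⁽ᵐ⁾`, where `F` lists the successive derivatives. -/
noncomputable def assocVal (m : ℕ) (F : ℕ → ℝ → ℝ) (z : ℝ) : ℝ := √(z ^ 2 - 1) ^ m * F m z

/-- The derivative of `assocVal m F` times `z² - 1`. -/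
noncomputable def assocFlux (m : ℕ) (F : ℕ → ℝ → ℝ) (z : ℝ) : ℝ :=
  √(z ^ 2 - 1) ^ m * (m * z * F m z + (z ^ 2 - 1) * F (m + 1) z)

theorem hasDerivAt_assocVal {F : ℕ → ℝ → ℝ} {m : ℕ} {z : ℝ} (hz : 1 < z)
    (hF : HasDerivAt (F m) (F (m + 1) z) z) :
    HasDerivAt (assocVal m F) (assocFlux m F z / (z ^ 2 - 1)) z := by
  refine ((hasDerivAt_sqrt_pow m hz).mul hF).congr_deriv ?_
  have := (sq_sub_one_pos hz).ne'
  rw [assocFlux]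
  field_simp

theorem hasDerivAt_assocFlux {F : ℕ → ℝ → ℝ} {N : ℝ} {m : ℕ} {z : ℝ} (hz : 1 < z)
    (hF : ∀ k, HasDerivAt (F k) (F (k + 1) z) z)
    (hN : (z ^ 2 - 1) * F (m + 2) z + 2 * (m + 1) * z * F (m + 1) z
      = (N - m * (m + 1)) * F m z) :
    HasDerivAt (assocFlux m F) ((N + m ^ 2 / (z ^ 2 - 1)) * assocVal m F z) z := by
  have hp := (sq_sub_one_pos hz).ne'
  have h := (hasDerivAt_sqrt_pow m hz).mul
    ((((hasDerivAt_id z).const_mul (m : ℝ)).mul (hF m)).add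
      ((hasDerivAt_sq_sub_one z).mul (hF (m + 1))))
  refine h.congr_deriv ?_
  simp only [Pi.add_apply, Pi.mul_apply, id]
  rw [assocVal]
  field_simp
  linear_combination (√(z ^ 2 - 1) ^ m) * (z ^ 2 - 1) * hN

/-! ### Asymptotics at infinity and construction of the solution pair. -/

theorem tendsto_div_sq_sub_one : Tendsto (fun z : ℝ => z / (z ^ 2 - 1)) atTop (𝓝 0) := by
  have h := div_tendsto_atTop_zero_of_degree_lt (X : ℝ[X]) (X ^ 2 - C 1)
    (by rw [degree_X_pow_sub_C two_pos, degree_X]; norm_num)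
  simpa using h

theorem self_le_legendreD {n : ℕ} (hn : 1 ≤ n) {z : ℝ} (hz : 1 ≤ z) : z ≤ legendreD n 0 z := by
  obtain ⟨k, rfl⟩ : ∃ k, n = k + 1 := ⟨n - 1, by omega⟩
  have h := sq_sub_one_mul_legendreD_one k z
  have h0 := one_le_legendreD (Nat.zero_le k) hz
  have hp : 0 ≤ z ^ 2 - 1 := by nlinarith
  have h2 : 0 ≤ (z ^ 2 - 1) * legendreD k 1 z := mul_nonneg hp (legendreD_nonneg k 1 hz)
  rw [h] at h2
  have := nonneg_of_mul_nonneg_right h2 (by positivity)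
  nlinarith

theorem tendsto_mul_legendreQ (n : ℕ) :
    Tendsto (fun z => z * (legendreD n 0 z * legendreQ n z)) atTop (𝓝 (1 / (2 * n + 1))) := by
  have hpos : ∀ z : ℝ, 1 < z → 0 < legendreD n 0 z := fun z hz => by
    linarith [one_le_legendreD (Nat.zero_le n) hz.le]
  refine tendsto_mul_of_wronskian (A := fun z => (z ^ 2 - 1) * legendreD n 1 z)
    (B := fun z => (z ^ 2 - 1) * legendreQD n 1 z) (Nat.cast_nonneg n) ?_ ?_ ?_ hpos ?_ ?_
    (tendsto_legendreQ_div_atTop n) ?_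
  · intro z hz
    rw [mul_div_cancel_left₀ _ (sq_sub_one_pos hz).ne']
    exact hasDerivAt_legendreD n 0 z
  · intro z hz
    rw [mul_div_cancel_left₀ _ (sq_sub_one_pos hz).ne']
    simpa [legendreQD_zero] using hasDerivAt_legendreQD n 0 hz
  · intro z hz
    linear_combination wronskian_zero hz n
  · intro z hz
    exact mul_nonneg (sq_sub_one_pos hz).le (legendreD_nonneg n 1 hz.le)
  · refine tendsto_atTop_mono' _ ?_ tendsto_id
    filter_upwards [eventually_gt_atTop 1] with z hz
    have := one_le_legendreD (Nat.zero_le n) hz.le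
    have hz0 : 0 < z := by linarith
    have h2 : 1 ≤ legendreD n 0 z ^ 2 := one_le_pow₀ this
    simp only [id]
    nlinarith
  · have h1 := tendsto_mul_legendreD_div (Nat.zero_le n)
    have e1 : Tendsto (fun z : ℝ => 1 - (z ^ 2)⁻¹) atTop (𝓝 (1 - 0)) :=
      tendsto_const_nhds.sub (tendsto_inv_atTop_zero.comp (tendsto_pow_atTop two_ne_zero))
    have h2 := e1.mul h1
    simp only [sub_zero, one_mul, Nat.cast_zero] at h2
    refine h2.congr' ?_
    filter_upwards [eventually_gt_atTop 1] with z hz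
    have h3 := (hpos z hz).ne'
    have h4 : z ≠ 0 := by linarith
    simp only [zero_add]
    field_simp

/-- Serves to show that v is recessive for every order. The two limits are proved jointly because
the differentiated equation expresses z Q^(m+2) as z/(z² - 1) times a combination of Q^(m) and z
Q^(m+1). -/
theorem tendsto_legendreQD_atTop {n : ℕ} (hn : 1 ≤ n) (m : ℕ) :
    Tendsto (legendreQD n m) atTop (𝓝 0) ∧
      Tendsto (fun z => z * legendreQD n (m + 1) z) atTop (𝓝 0) := by
  induction m with
  | zero =>
    have hinv : Tendsto (fun z => (z * legendreD n 0 z)⁻¹) atTop (𝓝 0) := by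
      refine tendsto_inv_atTop_zero.comp (tendsto_atTop_mono' _ ?_ tendsto_id)
      filter_upwards [eventually_gt_atTop 1] with z hz
      have := one_le_legendreD (Nat.zero_le n) hz.le
      simp only [id]
      nlinarith
    have hQ : Tendsto (legendreQD n 0) atTop (𝓝 0) := by
      have := (tendsto_mul_legendreQ n).mul hinv
      rw [mul_zero] at this
      refine this.congr' ?_
      filter_upwards [eventually_gt_atTop 1] with z hz
      have h3 : legendreD n 0 z ≠ 0 := by linarith [one_le_legendreD (Nat.zero_le n) hz.le]
      have h4 : z ≠ 0 := by linarith
      rw [legendreQD_zero]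
      field_simp
    refine ⟨hQ, ?_⟩
    have hinv' : Tendsto (fun z => (legendreD n 0 z)⁻¹) atTop (𝓝 0) := by
      refine tendsto_inv_atTop_zero.comp (tendsto_atTop_mono' _ ?_ tendsto_id)
      filter_upwards [eventually_gt_atTop 1] with z hz
      exact self_le_legendreD hn hz.le
    have := ((tendsto_mul_legendreD_div (Nat.zero_le n)).mul hQ).sub
      (tendsto_div_sq_sub_one.mul hinv')
    simp only [mul_zero, sub_zero] at this
    refine this.congr' ?_
    filter_upwards [eventually_gt_atTop 1] with z hz
    have h3 : legendreD n 0 z ≠ 0 := by linarith [one_le_legendreD (Nat.zero_le n) hz.le]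
    have h4 := (sq_sub_one_pos hz).ne'
    have h5 := wronskian_zero hz n
    rw [legendreQD_zero, zero_add]
    field_simp
    linear_combination h5
  | succ m ih =>
    obtain ⟨h1, h2⟩ := ih
    constructor
    · have := tendsto_inv_atTop_zero.mul h2
      rw [mul_zero] at this
      refine this.congr' ?_
      filter_upwards [eventually_gt_atTop 1] with z hz
      have h4 : z ≠ 0 := by linarith
      field_simp
    · have := tendsto_div_sq_sub_one.mul
        ((h1.const_mul (n * (n + 1) - m * (m + 1) : ℝ)).sub (h2.const_mul (2 * (m + 1) : ℝ)))
      rw [zero_mul] at this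
      refine this.congr' ?_
      filter_upwards [eventually_gt_atTop 1] with z hz
      have h4 := (sq_sub_one_pos hz).ne'
      have h5 := legendreQD_equation n m z hz
      field_simp
      linear_combination - h5

/-- The normalized derivatives of the Legendre function of the second kind. -/
noncomputable def normalizedQD (n m k : ℕ) (z : ℝ) : ℝ :=
  (-1) ^ m * (((n - m).factorial : ℝ) / ((n + m).factorial : ℝ)) * legendreQD n k z

theorem solutionPair {n m : ℕ} (hn : 1 ≤ n) (hm : m ≤ n) :
    SolutionPair n m (assocVal m (legendreD n)) (assocFlux m (legendreD n))
      (assocVal m (normalizedQD n m)) (assocFlux m (normalizedQD n m)) := by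
  have hU : ∀ z : ℝ, 1 < z → 0 < legendreD n m z := fun z hz => by
    linarith [one_le_legendreD hm hz.le]
  have hs : ∀ z : ℝ, 1 < z → 0 < √(z ^ 2 - 1) := fun z hz => Real.sqrt_pos.2 (sq_sub_one_pos hz)
  have hQ : ∀ z > 1, ∀ k, HasDerivAt (normalizedQD n m k) (normalizedQD n m (k + 1) z) z :=
    fun z hz k => (hasDerivAt_legendreQD n k hz).const_mul _
  have hu : ∀ z > 1, HasDerivAt (assocVal m (legendreD n))
      (assocFlux m (legendreD n) z / (z ^ 2 - 1)) z :=
    fun z hz => hasDerivAt_assocVal hz (hasDerivAt_legendreD n m z)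
  have hv : ∀ z > 1, HasDerivAt (assocVal m (normalizedQD n m))
      (assocFlux m (normalizedQD n m) z / (z ^ 2 - 1)) z :=
    fun z hz => hasDerivAt_assocVal hz (hQ z hz m)
  have hW : ∀ z > 1, assocFlux m (legendreD n) z * assocVal m (normalizedQD n m) z
      - assocVal m (legendreD n) z * assocFlux m (normalizedQD n m) z = 1 := by
    intro z hz
    have h1 := ProlateNP.wronskian hz hm
    have h2 : √(z ^ 2 - 1) ^ m * √(z ^ 2 - 1) ^ m = (z ^ 2 - 1) ^ m := by
      rw [← mul_pow, Real.mul_self_sqrt (sq_sub_one_pos hz).le]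
    have h3 : ((-1 : ℝ) ^ m) * (-1) ^ m = 1 := by rw [← mul_pow]; simp
    simp only [assocFlux, assocVal, normalizedQD]
    set s := √(z ^ 2 - 1) ^ m
    have h4 : ((n + m).factorial : ℝ) ≠ 0 := by positivity
    set f : ℝ := ((n - m).factorial : ℝ)
    set g : ℝ := ((n + m).factorial : ℝ)
    field_simp
    rw [pow_succ, ← h2] at h1
    linear_combination (-1) ^ m * h1 + g * h3
  have hupos : ∀ z > 1, 0 < assocVal m (legendreD n) z := fun z hz =>
    mul_pos (pow_pos (hs z hz) m) (hU z hz)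
  have hApos : ∀ z > 1, 0 < assocFlux m (legendreD n) z := by
    intro z hz
    refine mul_pos (pow_pos (hs z hz) m) ?_
    have hp := sq_sub_one_pos hz
    have hz0 : 0 < z := by linarith
    have hU' := legendreD_nonneg n (m + 1) hz.le
    rcases Nat.eq_zero_or_pos m with rfl | h0
    · have := one_le_legendreD hn hz.le
      have : 0 < (z ^ 2 - 1) * legendreD n 1 z := by positivity
      simpa using this
    · have := hU z hz
      have : (0 : ℝ) < m := by exact_mod_cast h0
      positivity
  have htop : Tendsto (assocVal m (legendreD n)) atTop atTop := by
    rcases Nat.eq_zero_or_pos m with rfl | h0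
    · refine tendsto_atTop_mono' _ ?_ tendsto_id
      filter_upwards [eventually_gt_atTop 1] with z hz
      simpa [assocVal] using self_le_legendreD hn hz.le
    · have h1 : Tendsto (fun z : ℝ => √(z ^ 2 - 1) ^ m) atTop atTop :=
        (tendsto_pow_atTop h0.ne').comp (Real.tendsto_sqrt_atTop.comp
          (tendsto_atTop_add_const_right _ _ (tendsto_pow_atTop two_ne_zero)))
      refine tendsto_atTop_mono' _ ?_ h1
      filter_upwards [eventually_gt_atTop 1] with z hz
      exact le_mul_of_one_le_right (pow_pos (hs z hz) m).le (one_le_legendreD hm hz.le)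
  have hratio : Tendsto (fun z => assocVal m (normalizedQD n m) z / assocVal m (legendreD n) z)
      atTop (𝓝 0) := by
    have h1 := (tendsto_legendreQD_atTop hn m).1.const_mul
      ((-1) ^ m * (((n - m).factorial : ℝ) / ((n + m).factorial : ℝ)))
    rw [mul_zero] at h1
    refine squeeze_zero_norm' ?_ (tendsto_norm_zero.comp h1)
    filter_upwards [eventually_gt_atTop 1] with z hz
    rw [assocVal, assocVal, mul_div_mul_left _ _ (pow_pos (hs z hz) m).ne', norm_div]
    refine div_le_self (norm_nonneg _) ?_
    rw [Real.norm_of_nonneg (hU z hz).le]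
    exact one_le_legendreD hm hz.le
  have hexp : Tendsto (fun z => assocFlux m (legendreD n) z / (z * assocVal m (legendreD n) z))
      atTop (𝓝 n) := by
    have h1 := tendsto_mul_legendreD_div hm
    have e1 : Tendsto (fun z : ℝ => 1 - (z ^ 2)⁻¹) atTop (𝓝 (1 - 0)) :=
      tendsto_const_nhds.sub (tendsto_inv_atTop_zero.comp (tendsto_pow_atTop two_ne_zero))
    have h2 := (e1.mul h1).const_add (m : ℝ)
    rw [sub_zero, one_mul, add_sub_cancel] at h2
    refine h2.congr' ?_
    filter_upwards [eventually_gt_atTop 1] with z hz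
    have h3 := (hU z hz).ne'
    have h4 : z ≠ 0 := by linarith
    have h5 := (pow_pos (hs z hz) m).ne'
    simp only [assocFlux, assocVal]
    field_simp
  refine ⟨hu, fun z hz => hasDerivAt_assocFlux hz (fun k => hasDerivAt_legendreD n k z)
    (legendreD_equation n m z hz), hv, fun z hz => hasDerivAt_assocFlux hz (hQ z hz) ?_, hW,
    hupos, hApos, ?_, htop, hexp, hratio, ?_⟩
  · simp only [normalizedQD]
    linear_combination ((-1) ^ m * (((n - m).factorial : ℝ) / ((n + m).factorial : ℝ))) *
      legendreQD_equation n m z hz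
  · refine tendsto_mul_of_wronskian (Nat.cast_nonneg n) hu hv hW hupos
      (fun z hz => (hApos z hz).le) ?_ hratio hexp
    exact tendsto_id.atTop_mul_atTop₀ ((tendsto_pow_atTop two_ne_zero).comp htop)
  · have h0 := continuous_legendreD n m
    have h1 := continuous_legendreD n (m + 1)
    have h2 := continuous_charRoot n m
    have hc : Continuous fun z => assocFlux m (legendreD n) z
        - charRoot n m z * assocVal m (legendreD n) z := by
      unfold assocFlux assocVal
      fun_prop
    -- At z = 1 the root equals m, and A equals m u there, so the two terms cancel for every m,
    -- including 0.
    refine (hc.tendsto' 1 0 ?_).mono_left nhdsWithin_le_nhds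
    simp [assocFlux, assocVal, charRoot]
    ring

theorem eigenvalue_eq {n : ℕ} (hn : 1 ≤ n) {m : ℤ} (h1 : -(n : ℤ) ≤ m) (h2 : m ≤ n) {z : ℝ}
    (hz : 1 < z) : eigenvalue m n z = 1 / 2 -
      assocFlux m.natAbs (legendreD n) z * assocVal m.natAbs (normalizedQD n m.natAbs) z := by
  have hk : m.natAbs ≤ n := by omega
  have hp := (sq_sub_one_pos hz).ne'
  have hpair := solutionPair hn hk
  have hW := hpair.wronskian z hz
  have hd : HasDerivAt (fun z => assocLegendreP m n z * assocLegendreQ m n z)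
      (orderFactor m n ^ 2 * (assocFlux m.natAbs (legendreD n) z
        * assocVal m.natAbs (legendreQD n) z + assocVal m.natAbs (legendreD n) z *
        assocFlux m.natAbs (legendreQD n) z) / (z ^ 2 - 1)) z := by
    have e1 : assocLegendreP m n = fun z => orderFactor m n * assocVal m.natAbs (legendreD n) z :=
      funext fun z => by rw [assocLegendreP, iteratedDeriv_legendreP, assocVal]
    have e2 : assocLegendreQ m n =
        fun z => orderFactor m n * assocVal m.natAbs (legendreQD n) z := rfl
    rw [e1, e2]
    refine (((hpair.hasDerivAt_u z hz).const_mul _).mul ((hasDerivAt_assocVal hz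
      (hasDerivAt_legendreQD n m.natAbs hz)).const_mul _)).congr_deriv ?_
    ring
  rw [eigenvalue, hd.deriv]
  -- For m = -k the prefactor is (n+k)!/(n-k)!, and the squared order factor turns it into
  -- (n-k)!/(n+k)!. Thus only |m| matters.
  have hc : (-1 : ℝ) ^ m * ((((n : ℤ) - m).toNat.factorial : ℝ) /
      (((n : ℤ) + m).toNat.factorial : ℝ)) * orderFactor m n ^ 2 = (-1) ^ m.natAbs *
      (((n - m.natAbs).factorial : ℝ) / ((n + m.natAbs).factorial : ℝ)) := by
    rcases le_total 0 m with h0 | h0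
    · obtain ⟨k, rfl⟩ := Int.eq_ofNat_of_zero_le h0
      have e1 : ((n : ℤ) - k).toNat = n - k := by omega
      have e2 : ((n : ℤ) + k).toNat = n + k := by omega
      simp [orderFactor, e1, e2]
    · rcases h0.eq_or_lt with rfl | h0'
      · simp [orderFactor]
      obtain ⟨k, rfl⟩ := Int.exists_eq_neg_ofNat h0
      have e1 : ((n : ℤ) - -(k : ℤ)).toNat = n + k := by omega
      have e2 : ((n : ℤ) + -(k : ℤ)).toNat = n - k := by omega
      have h3 : ¬ (0 ≤ -(k : ℤ)) := by omega
      have h4 : (-1 : ℝ) ^ (-(k : ℤ)) = (-1) ^ k := by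
        rw [zpow_neg, zpow_natCast, ← inv_pow]; norm_num
      rw [orderFactor, if_neg h3, e1, e2, h4, Int.natAbs_neg, Int.natAbs_natCast]
      field_simp
  have hv : assocVal m.natAbs (normalizedQD n m.natAbs) z = (-1) ^ m.natAbs *
      (((n - m.natAbs).factorial : ℝ) / ((n + m.natAbs).factorial : ℝ)) *
      assocVal m.natAbs (legendreQD n) z := by
    simp only [assocVal, normalizedQD]; ring
  have hB : assocFlux m.natAbs (normalizedQD n m.natAbs) z = (-1) ^ m.natAbs *
      (((n - m.natAbs).factorial : ℝ) / ((n + m.natAbs).factorial : ℝ)) *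
      assocFlux m.natAbs (legendreQD n) z := by
    simp only [assocFlux, normalizedQD]; ring
  rw [hv, hB, ← hc] at hW
  rw [hv, ← hc]
  set c := (-1 : ℝ) ^ m * ((((n : ℤ) - m).toNat.factorial : ℝ) /
      (((n : ℤ) + m).toNat.factorial : ℝ)) with hcdef
  rw [mul_assoc (-1 / 2 : ℝ), ← hcdef]
  field_simp
  linear_combination hW

/-! ### Behaviour of the eigenvalues -/

theorem eigenvalue_mem_Ioo {n : ℕ} (hn : 1 ≤ n) {m : ℤ} (h1 : -(n : ℤ) ≤ m) (h2 : m ≤ n) {z : ℝ}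
    (hz : 1 < z) : eigenvalue m n z ∈ Set.Ioo (0 : ℝ) (1 / 2) := by
  have hpair := solutionPair hn (show m.natAbs ≤ n by omega)
  rw [eigenvalue_eq hn h1 h2 hz]
  have h3 := hpair.A_mul_v_pos hz
  have h4 := hpair.A_mul_v_lt hn hz
  constructor <;> linarith

theorem continuousOn_eigenvalue {n : ℕ} (hn : 1 ≤ n) {m : ℤ} (h1 : -(n : ℤ) ≤ m) (h2 : m ≤ n) :
    ContinuousOn (eigenvalue m n) (Set.Ioi 1) :=
  (continuousOn_const.sub
    (solutionPair hn (show m.natAbs ≤ n by omega)).continuousOn_A_mul_v).congr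
      fun _ hz => eigenvalue_eq hn h1 h2 hz

theorem half_sub_div (n : ℕ) : (1 : ℝ) / 2 - n / (2 * n + 1) = 1 / (2 * (2 * n + 1)) := by
  have : (2 * n + 1 : ℝ) ≠ 0 := by positivity
  field_simp
  ring

theorem tendsto_eigenvalue_atTop {n : ℕ} (hn : 1 ≤ n) {m : ℤ} (h1 : -(n : ℤ) ≤ m) (h2 : m ≤ n) :
    Tendsto (eigenvalue m n) atTop (𝓝 (1 / (2 * (2 * n + 1)))) := by
  rw [← half_sub_div]
  refine ((solutionPair hn (show m.natAbs ≤ n by omega)).tendsto_A_mul_v.const_sub (1 / 2)).congr' ?_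
  filter_upwards [eventually_gt_atTop 1] with z hz
  exact (eigenvalue_eq hn h1 h2 hz).symm

/-! ### Limits of the eigenvalues at 1. -/

theorem tendsto_sq_sub_one_mul_legendreQ (n : ℕ) :
    Tendsto (fun z => (z ^ 2 - 1) * legendreQ n z) (𝓝[>] 1) (𝓝 0) := by
  have hP := ((continuous_legendreD n 0).tendsto 1).mono_left (nhdsWithin_le_nhds (s := Set.Ioi 1))
  have hW : Tendsto (fun z : ℝ => (z ^ 2 - 1) * (legendreW n).eval z) (𝓝[>] 1) (𝓝 0) := by
    have : Continuous fun z : ℝ => (z ^ 2 - 1) * (legendreW n).eval z := by fun_prop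
    exact (this.tendsto' 1 0 (by simp)).mono_left nhdsWithin_le_nhds
  have := (hP.mul tendsto_sq_sub_one_mul_halfLog).sub hW
  rw [mul_zero, sub_zero] at this
  refine this.congr fun z => ?_
  rw [legendreQ_eq]
  ring

theorem tendsto_eigenvalue_zero {n : ℕ} (hn : 1 ≤ n) :
    Tendsto (eigenvalue 0 n) (𝓝[>] 1) (𝓝 (1 / 2)) := by
  have hP := ((continuous_legendreD n 1).tendsto 1).mono_left (nhdsWithin_le_nhds (s := Set.Ioi 1))
  have h := (hP.mul (tendsto_sq_sub_one_mul_legendreQ n)).const_sub (1 / 2)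
  rw [mul_zero, sub_zero] at h
  refine h.congr' ?_
  filter_upwards [self_mem_nhdsWithin] with z hz
  have hf : (n.factorial : ℝ) ≠ 0 := by positivity
  rw [eigenvalue_eq hn (by omega) (by omega) hz]
  simp [assocFlux, assocVal, normalizedQD, legendreQD_zero, div_self hf]
  ring

theorem tendsto_sq_sub_one_mul_legendreQD_one (n : ℕ) :
    Tendsto (fun z => (z ^ 2 - 1) * legendreQD n 1 z) (𝓝[>] 1) (𝓝 (-1)) := by
  have h0 := ((continuous_legendreD n 0).tendsto 1).mono_left (nhdsWithin_le_nhds (s := Set.Ioi 1))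
  have h1 := ((continuous_legendreD n 1).tendsto 1).mono_left (nhdsWithin_le_nhds (s := Set.Ioi 1))
  rw [legendreD_zero_apply_one] at h0
  have h := ((h1.mul (tendsto_sq_sub_one_mul_legendreQ n)).sub_const 1).div h0 one_ne_zero
  rw [mul_zero, zero_sub, div_one] at h
  refine h.congr' ?_
  filter_upwards [self_mem_nhdsWithin] with z hz
  have hz : 1 < z := hz
  have h3 : legendreD n 0 z ≠ 0 := by linarith [one_le_legendreD (Nat.zero_le n) hz.le]
  simp only [Pi.div_apply]
  field_simp
  linear_combination wronskian_zero hz n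

/-- Here A v is -1/(n(n+1)) times the product of z P_n' + (z² - 1) P_n'' and (z² - 1) Q_n'. The
factors tend to n(n+1)/2 and -1, so A v → 1/2. -/
theorem tendsto_eigenvalue_one {n : ℕ} (hn : 1 ≤ n) :
    Tendsto (eigenvalue 1 n) (𝓝[>] 1) (𝓝 0) := by
  have h1 := continuous_legendreD n 1
  have h2 := continuous_legendreD n 2
  have hA : Tendsto (fun z => z * legendreD n 1 z + (z ^ 2 - 1) * legendreD n 2 z) (𝓝[>] 1)
      (𝓝 ((n : ℝ) * (n + 1) / 2)) := by
    refine Continuous.tendsto' (by fun_prop) _ _ ?_ |>.mono_left nhdsWithin_le_nhds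
    linarith [legendreD_one_apply_one n]
  have hn' : (0 : ℝ) < n := by exact_mod_cast hn
  have h := ((hA.mul (tendsto_sq_sub_one_mul_legendreQD_one n)).mul_const
    (1 / (n * (n + 1) : ℝ))).const_add (1 / 2)
  have e : (1 / 2 : ℝ) + n * (n + 1) / 2 * -1 * (1 / (n * (n + 1))) = 0 := by
    field_simp
    ring
  rw [e] at h
  refine h.congr' ?_
  filter_upwards [self_mem_nhdsWithin] with z hz
  have hp := sq_sub_one_pos hz
  rw [eigenvalue_eq hn (by omega) (by omega) hz]
  have hf : (((n - 1).factorial : ℝ) / ((n + 1).factorial : ℝ)) = 1 / (n * (n + 1)) := by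
    obtain ⟨k, rfl⟩ : ∃ k, n = k + 1 := ⟨n - 1, by omega⟩
    rw [Nat.factorial_succ (k + 1), Nat.factorial_succ k, Nat.add_sub_cancel]
    push_cast
    field_simp
  simp only [assocFlux, assocVal, normalizedQD, Int.natAbs_one, pow_one, hf, Nat.cast_one]
  linear_combination - (1 / (n * (n + 1))) * legendreQD n 1 z * (z * legendreD n 1 z
    + (z ^ 2 - 1) * legendreD n 2 z) * Real.mul_self_sqrt hp.le

theorem legendreD_one_eq {k : ℕ} {z : ℝ} (hz : 1 < z) :
    legendreD k 1 z = z * legendreD (k + 1) 1 z - (k + 1) * legendreD (k + 1) 0 z := by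
  apply mul_left_cancel₀ (sq_sub_one_pos hz).ne'
  linear_combination sq_sub_one_mul_legendreD_one k z
    - z * sq_sub_one_mul_legendreD_succ_one k z

/-- With n = k + 1, A/u = n z - e where e = (n+1) P_k'/P_n'. In the inequality required by
`exists_A_mul_v_lt` the z² terms cancel, so the limit of z e decides its sign. -/
theorem exists_lt_eigenvalue_one {n : ℕ} (hn : 2 ≤ n) :
    ∃ z > 1, 1 / (2 * (2 * (n : ℝ) + 1)) < eigenvalue 1 n z := by
  have hn1 : 1 ≤ n := by omega
  have hpair := solutionPair hn1 hn1
  suffices ∀ᶠ z in atTop, (n + 1) * assocFlux 1 (legendreD n) z ^ 2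
      < n * charRoot n 1 z ^ 2 * assocVal 1 (legendreD n) z ^ 2 by
    obtain ⟨z, hz, h⟩ := hpair.exists_A_mul_v_lt hn1 this
    refine ⟨z, hz, ?_⟩
    rw [eigenvalue_eq hn1 (by omega) (by omega) hz, ← half_sub_div]
    simp only [Int.natAbs_one]
    linarith
  obtain ⟨k, rfl⟩ : ∃ k, n = k + 1 := ⟨n - 1, by omega⟩
  have hk : 1 ≤ k := by omega
  have hk' : (1 : ℝ) ≤ k := by exact_mod_cast hk
  set e : ℝ → ℝ := fun z => (k + 2) * legendreD k 1 z / legendreD (k + 1) 1 z with he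
  -- From P_{k+1}' = z P_k' + (k+1) P_k, the quotient P_{k+1}'/(z P_k') is 1 + (k+1)/(z P_k'/P_k),
  -- and z P_k'/P_k → k.
  have hze : Tendsto (fun z => z * e z) atTop (𝓝 ((k + 2) / (1 + (k + 1) / k))) := by
    have h1 := tendsto_mul_legendreD_div (Nat.zero_le k)
    rw [Nat.cast_zero, sub_zero] at h1
    have h2 := (tendsto_const_nhds (x := (k + 2 : ℝ))).div
      (((tendsto_const_nhds (x := (k + 1 : ℝ))).div h1 (by linarith)).const_add 1)
      (by positivity)
    refine h2.congr' ?_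
    filter_upwards [eventually_gt_atTop 1] with z hz
    have a0 := one_le_legendreD (Nat.zero_le k) hz.le
    have a1 := one_le_legendreD hk hz.le
    have a2 := one_le_legendreD hn1 hz.le
    have a3 := legendreD_succ_succ k 0 z
    simp only [zero_add, Nat.cast_zero, add_zero] at a3
    have hz0 : 0 < z := by linarith
    have a4 : 0 < legendreD k 0 z := by linarith
    have a5 : 0 < legendreD k 1 z := by linarith
    have a6 : 1 + (k + 1) / (z * legendreD k 1 z / legendreD k 0 z)
        = legendreD (k + 1) 1 z / (z * legendreD k 1 z) := by
      rw [a3]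
      field_simp
    simp only [Pi.div_apply, zero_add, he]
    rw [a6]
    have a7 : 0 < legendreD (k + 1) 1 z := by linarith
    field_simp
  have he0 : Tendsto e atTop (𝓝 0) := by
    have := tendsto_inv_atTop_zero.mul hze
    rw [zero_mul] at this
    refine this.congr' ?_
    filter_upwards [eventually_gt_atTop 1] with z hz
    have h4 : z ≠ 0 := by linarith
    field_simp
  have hlim := ((hze.const_mul (2 * (k + 1) * (k + 2) : ℝ)).sub
    ((he0.pow 2).const_mul (k + 2 : ℝ))).const_add (-(k + 1) ^ 2 * (k + 2) + (k + 1) : ℝ)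
  -- The sign is that of k² + 3k - 1, positive for k ≥ 1 but not for k = 0; this is where n ≥ 2 is
  -- needed.
  have hpos : (0 : ℝ) < (-(k + 1) ^ 2 * (k + 2) + (k + 1))
      + (2 * (k + 1) * (k + 2) * ((k + 2) / (1 + (k + 1) / k)) - (k + 2) * 0 ^ 2) := by
    have : (-(k + 1 : ℝ) ^ 2 * (k + 2) + (k + 1))
      + (2 * (k + 1) * (k + 2) * ((k + 2) / (1 + (k + 1) / k)) - (k + 2) * 0 ^ 2)
      = (k + 1) * (k ^ 2 + 3 * k - 1) / (2 * k + 1) := by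
      have h1 : (k : ℝ) ≠ 0 := by linarith
      have h2 : (1 + (k + 1) / k : ℝ) = (2 * k + 1) / k := by field_simp; ring
      rw [h2]
      field_simp
      ring
    rw [this]
    have : 0 < (k : ℝ) ^ 2 + 3 * k - 1 := by nlinarith
    positivity
  filter_upwards [hlim.eventually (lt_mem_nhds hpos), eventually_gt_atTop 1] with z hz1 hz
  have a2 : 0 < legendreD (k + 1) 1 z := by linarith [one_le_legendreD hn1 hz.le]
  have hp := sq_sub_one_pos hz
  have hflux : assocFlux 1 (legendreD (k + 1)) z
      = assocVal 1 (legendreD (k + 1)) z * ((k + 1) * z - e z) := by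
    have h1 := legendreD_equation (k + 1) 0 z hz
    have h2 := legendreD_one_eq (k := k) hz
    simp only [assocFlux, assocVal, he, pow_one]
    field_simp
    push_cast at h1 ⊢
    simp only [zero_add] at h1
    linear_combination h1 + (k + 2) * h2
  rw [hflux, charRoot_sq hn1 hz]
  have hu := hpair.u_pos z hz
  have := mul_pos hz1 (pow_pos hu 2)
  push_cast
  linarith

theorem exists_eigenvalue_zero_lt {x b : ℝ} (hx : 0 < x) (hb : 1 < b) :
    ∃ n : ℕ, 1 ≤ n ∧ ∃ z, 1 < z ∧ z ≤ b ∧ eigenvalue 0 n z < x := by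
  obtain ⟨a, ha, hab⟩ := exists_between hb
  have hpa := sq_sub_one_pos ha
  have hpb := sq_sub_one_pos hb
  -- On [a, b], away from 1, the mean value theorem gives a point c whose eigenvalue is half of (c²
  -- - 1)(u(a)v(a) - u(b)v(b))/(b - a). Since u(a)v(a) < 1/(n √(a² - 1)), this n makes that product
  -- less than x.
  obtain ⟨n, hn⟩ := exists_nat_gt ((b ^ 2 - 1) / (x * (b - a) * √(a ^ 2 - 1)))
  have hba : 0 < b - a := by linarith
  have hsa := Real.sqrt_pos.2 hpa
  have hn0 : (0 : ℝ) < n := lt_trans (by positivity) hn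
  have hn1 : 1 ≤ n := by exact_mod_cast hn0
  have hpair := solutionPair hn1 (Nat.zero_le n)
  set u := assocVal 0 (legendreD n)
  set A := assocFlux 0 (legendreD n)
  set v := assocVal 0 (normalizedQD n 0)
  set B := assocFlux 0 (normalizedQD n 0)
  have hd : ∀ z > 1, HasDerivAt (fun z => u z * v z) ((A z * v z + u z * B z) / (z ^ 2 - 1)) z :=
    fun z hz => ((hpair.hasDerivAt_u z hz).mul (hpair.hasDerivAt_v z hz)).congr_deriv (by ring)
  obtain ⟨c, hc, hc'⟩ := exists_hasDerivAt_eq_slope (fun z => u z * v z)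
    (fun z => (A z * v z + u z * B z) / (z ^ 2 - 1)) hab
    (fun z hz => (hd z (ha.trans_le hz.1)).continuousAt.continuousWithinAt)
    (fun z hz => hd z (ha.trans hz.1))
  have hc1 : 1 < c := ha.trans hc.1
  refine ⟨n, hn1, c, hc1, hc.2.le, ?_⟩
  rw [eigenvalue_eq hn1 (by omega) (by omega) hc1]
  change 1 / 2 - A c * v c < x
  have hW := hpair.wronskian c hc1
  have hpc := sq_sub_one_pos hc1
  have hub : 0 < u b * v b := mul_pos (hpair.u_pos b hb) (hpair.v_pos hb)
  have hua : u a * v a < 1 / (n * √(a ^ 2 - 1)) := by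
    rw [lt_div_iff₀ (by positivity)]
    refine lt_of_le_of_lt ?_ (hpair.charRoot_mul_lt_one hn1 ha)
    rw [mul_comm]
    refine mul_le_mul_of_nonneg_right ?_ (mul_pos (hpair.u_pos a ha) (hpair.v_pos ha)).le
    rw [charRoot]
    apply Real.le_sqrt_of_sq_le
    rw [mul_pow, Real.sq_sqrt hpa.le]
    push_cast
    nlinarith [mul_pos hn0 hpa]
  have hslope : A c * v c + u c * B c = -((c ^ 2 - 1) * ((u a * v a - u b * v b) / (b - a))) := by
    rw [div_eq_iff hpc.ne'] at hc'
    rw [hc']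
    ring
  have hbound : (c ^ 2 - 1) * ((u a * v a - u b * v b) / (b - a)) < x := by
    have hcb : c ^ 2 - 1 ≤ b ^ 2 - 1 := by nlinarith [hc.2]
    have h1 : (u a * v a - u b * v b) / (b - a) < 1 / (n * √(a ^ 2 - 1)) / (b - a) :=
      div_lt_div_of_pos_right (by linarith) hba
    calc (c ^ 2 - 1) * ((u a * v a - u b * v b) / (b - a))
        < (c ^ 2 - 1) * (1 / (n * √(a ^ 2 - 1)) / (b - a)) := mul_lt_mul_of_pos_left h1 hpc
      _ ≤ (b ^ 2 - 1) * (1 / (n * √(a ^ 2 - 1)) / (b - a)) :=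
          mul_le_mul_of_nonneg_right hcb (by positivity)
      _ < x := by
          rw [div_lt_iff₀ (by positivity)] at hn
          have : (b ^ 2 - 1) * (1 / (n * √(a ^ 2 - 1)) / (b - a))
              = (b ^ 2 - 1) / (n * √(a ^ 2 - 1) * (b - a)) := by field_simp
          rw [this, div_lt_iff₀ (by positivity)]
          linarith
  linarith

/-! ### The range of the eigenvalues -/

theorem exists_eigenvalue_eq {n : ℕ} (hn : 1 ≤ n) {m : ℤ} (h1 : -(n : ℤ) ≤ m) (h2 : m ≤ n)
    {x a b : ℝ} (ha : 1 < a) (hb : 1 < b) (hxa : eigenvalue m n a ≤ x)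
    (hxb : x ≤ eigenvalue m n b) : ∃ z, 1 < z ∧ z ≤ max a b ∧ eigenvalue m n z = x := by
  have hpre : IsPreconnected (Set.Ioc 1 (max a b)) := isPreconnected_Ioc
  obtain ⟨z, hz, h⟩ := hpre.intermediate_value ⟨ha, le_max_left a b⟩ ⟨hb, le_max_right a b⟩
    ((continuousOn_eigenvalue hn h1 h2).mono fun z hz => hz.1) ⟨hxa, hxb⟩
  exact ⟨z, hz.1, hz.2, h⟩

theorem exists_eigenvalue_zero_gt {n : ℕ} (hn : 1 ≤ n) {x b : ℝ} (hx : x < 1 / 2) (hb : 1 < b) :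
    ∃ z, 1 < z ∧ z ≤ b ∧ x < eigenvalue 0 n z := by
  have h1 := (tendsto_eigenvalue_zero hn).eventually (lt_mem_nhds hx)
  have h2 : ∀ᶠ z in 𝓝[>] (1 : ℝ), z ∈ Set.Ioc 1 b := Ioc_mem_nhdsGT hb
  obtain ⟨z, hz1, hz2⟩ := (h1.and h2).exists
  exact ⟨z, hz2.1, hz2.2, hz1⟩

theorem exists_eigenvalue_one_lt {n : ℕ} (hn : 1 ≤ n) {x : ℝ} (hx : 0 < x) :
    ∃ z, 1 < z ∧ eigenvalue 1 n z < x := by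
  have h1 := (tendsto_eigenvalue_one hn).eventually (gt_mem_nhds hx)
  obtain ⟨z, hz1, hz2⟩ := (h1.and self_mem_nhdsWithin).exists
  exact ⟨z, hz2, hz1⟩

/-- Values below that of the sphere come from m = 1, whose limits are 0 at 1 and the sphere value at
infinity; values above it come from m = 0, which starts from 1/2. -/
theorem exists_eigenvalue_eq_of_ne {n : ℕ} (hn : 1 ≤ n) {x : ℝ} (hx : x ∈ Set.Ioo (0 : ℝ) (1 / 2))
    (hne : x ≠ 1 / (2 * (2 * n + 1))) :
    ∃ m : ℤ, -(n : ℤ) ≤ m ∧ m ≤ n ∧ ∃ z, 1 < z ∧ eigenvalue m n z = x := by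
  rcases lt_or_gt_of_ne hne with h | h
  · obtain ⟨a, ha, hxa⟩ := exists_eigenvalue_one_lt hn hx.1
    obtain ⟨b, hxb, hb⟩ := (((tendsto_eigenvalue_atTop hn (m := 1) (by omega)
      (by omega)).eventually (lt_mem_nhds h)).and (eventually_gt_atTop 1)).exists
    obtain ⟨z, hz, -, h⟩ := exists_eigenvalue_eq hn (by omega) (by omega) ha hb hxa.le hxb.le
    exact ⟨1, by omega, by omega, z, hz, h⟩
  · obtain ⟨b, hb, -, hxb⟩ := exists_eigenvalue_zero_gt hn hx.2 one_lt_two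
    obtain ⟨a, hxa, ha⟩ := (((tendsto_eigenvalue_atTop hn (m := 0) (by omega)
      (by omega)).eventually (gt_mem_nhds h)).and (eventually_gt_atTop 1)).exists
    obtain ⟨z, hz, -, h⟩ := exists_eigenvalue_eq hn (by omega) (by omega) ha hb hxa.le hxb.le
    exact ⟨0, by omega, by omega, z, hz, h⟩

theorem exists_eigenvalue_eq_sphere {n : ℕ} (hn : 2 ≤ n) :
    ∃ z, 1 < z ∧ eigenvalue 1 n z = 1 / (2 * (2 * n + 1)) := by
  have hn1 : 1 ≤ n := by omega
  obtain ⟨a, ha, hxa⟩ := exists_eigenvalue_one_lt hn1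
    (show (0 : ℝ) < 1 / (2 * (2 * n + 1)) by positivity)
  obtain ⟨b, hb, hxb⟩ := exists_lt_eigenvalue_one hn
  obtain ⟨z, hz, -, h⟩ := exists_eigenvalue_eq hn1 (by omega) (by omega) ha hb hxa.le hxb.le
  exact ⟨z, hz, h⟩

theorem exists_eigenvalue_zero_eq {x b : ℝ} (hx : x ∈ Set.Ioo (0 : ℝ) (1 / 2)) (hb : 1 < b) :
    ∃ n : ℕ, 1 ≤ n ∧ ∃ z, 1 < z ∧ z ≤ b ∧ eigenvalue 0 n z = x := by
  obtain ⟨n, hn, c, hc, hcb, hxc⟩ := exists_eigenvalue_zero_lt hx.1 hb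
  obtain ⟨d, hd, hdb, hxd⟩ := exists_eigenvalue_zero_gt hn hx.2 hb
  obtain ⟨z, hz, hzb, h⟩ := exists_eigenvalue_eq hn (by omega) (by omega) hc hd hxc.le hxd.le
  exact ⟨n, hn, z, hz, hzb.trans (max_le hcb hdb), h⟩

theorem eigenvalueExt_coe (m : ℤ) (n : ℕ) (z : ℝ) :
    eigenvalueExt m n (z : EReal) = eigenvalue m n z := by
  simp [eigenvalueExt]

theorem eigenvalueExt_top (m : ℤ) (n : ℕ) :
    eigenvalueExt m n ⊤ = 1 / (2 * (2 * (n : ℝ) + 1)) := by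
  simp [eigenvalueExt]

theorem eigenvalueExt_mem_Ioo {n : ℕ} (hn : 1 ≤ n) {m : ℤ} (h1 : -(n : ℤ) ≤ m) (h2 : m ≤ n)
    {L : EReal} (hL : 1 < L) : eigenvalueExt m n L ∈ Set.Ioo (0 : ℝ) (1 / 2) := by
  induction L with
  | bot => exact absurd hL (by simp)
  | coe z =>
    rw [eigenvalueExt_coe]
    exact eigenvalue_mem_Ioo hn h1 h2 (by exact_mod_cast hL)
  | top =>
    rw [eigenvalueExt_top]
    have hn' : (0 : ℝ) < n := by exact_mod_cast hn
    exact ⟨by positivity, one_div_lt_one_div_of_lt two_pos (by linarith)⟩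

end ProlateNP

theorem mainTheorem6 :
    (∀ n : ℕ, 1 ≤ n →
      (⋃ L ∈ Set.Ioi (1 : EReal),
        {x : ℝ | ∃ m : ℤ, -(n : ℤ) ≤ m ∧ m ≤ n ∧ x = ProlateNP.eigenvalueExt m n L}) =
        Set.Ioo (0 : ℝ) (1 / 2)) ∧
    (∀ n : ℕ, 2 ≤ n →
      (⋃ L ∈ Set.Ioi (1 : ℝ),
        {x : ℝ | ∃ m : ℤ, -(n : ℤ) ≤ m ∧ m ≤ n ∧ x = ProlateNP.eigenvalue m n L}) =
        Set.Ioo (0 : ℝ) (1 / 2)) ∧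
    (∀ L₀ : EReal, 1 < L₀ →
      (⋃ L ∈ Set.Ioc (1 : EReal) L₀,
        {x : ℝ | ∃ n : ℕ, 1 ≤ n ∧ x = ProlateNP.eigenvalueExt 0 n L}) =
        Set.Ioo (0 : ℝ) (1 / 2)) := by
  refine ⟨fun n hn => ?_, fun n hn => ?_, fun L₀ hL₀ => ?_⟩
  · ext x
    simp only [Set.mem_iUnion, Set.mem_ofPred_eq, exists_prop]
    constructor
    · rintro ⟨L, hL, m, h1, h2, rfl⟩
      exact ProlateNP.eigenvalueExt_mem_Ioo hn h1 h2 hL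
    · intro hx
      by_cases hne : x = 1 / (2 * (2 * n + 1))
      · exact ⟨⊤, EReal.coe_lt_top 1, 0, by omega, by omega,
          by rw [hne, ProlateNP.eigenvalueExt_top]⟩
      · obtain ⟨m, h1, h2, z, hz, h⟩ := ProlateNP.exists_eigenvalue_eq_of_ne hn hx hne
        exact ⟨z, Set.mem_Ioi.2 (by exact_mod_cast hz), m, h1, h2, by rw [ProlateNP.eigenvalueExt_coe, h]⟩
  · ext x
    simp only [Set.mem_iUnion, Set.mem_ofPred_eq, exists_prop]
    constructor
    · rintro ⟨L, hL, m, h1, h2, rfl⟩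
      exact ProlateNP.eigenvalue_mem_Ioo (by omega) h1 h2 hL
    · intro hx
      by_cases hne : x = 1 / (2 * (2 * n + 1))
      · obtain ⟨z, hz, h⟩ := ProlateNP.exists_eigenvalue_eq_sphere hn
        exact ⟨z, hz, 1, by omega, by omega, by rw [hne, h]⟩
      · obtain ⟨m, h1, h2, z, hz, h⟩ :=
          ProlateNP.exists_eigenvalue_eq_of_ne (by omega) hx hne
        exact ⟨z, hz, m, h1, h2, h.symm⟩
  · ext x
    simp only [Set.mem_iUnion, Set.mem_ofPred_eq, exists_prop]
    constructor
    · rintro ⟨L, hL, n, hn, rfl⟩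
      exact ProlateNP.eigenvalueExt_mem_Ioo hn (by omega) (by omega) hL.1
    · intro hx
      -- A real b strictly between 1 and L₀ treats finite and infinite L₀ alike.
      obtain ⟨b, hb, hbL⟩ := EReal.lt_iff_exists_real_btwn.1 hL₀
      obtain ⟨n, hn, z, hz, hzb, h⟩ :=
        ProlateNP.exists_eigenvalue_zero_eq hx (show 1 < b by exact_mod_cast hb)
      exact ⟨z, ⟨by exact_mod_cast hz, (EReal.coe_le_coe_iff.2 hzb).trans hbL.le⟩, n, hn,
        by rw [ProlateNP.eigenvalueExt_coe, h]⟩
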